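/- Let $n$ and $k$ be integers with $1\le k\le n-1$, and let $\mathcal N$ be the real vector space (hence smooth manifold) of real symmetric $n\times n$ matrices $A=(a_{ij})$ of bandwidth at most $k$, that is, with $a_{ij}=0$ whenever $|i-j|>k$. Let $\mathcal D\subset\mathcal N$ be the set of derogatory matrices in $\mathcal N$, i.e., those having an eigenvalue of geometric multiplicity greater than $1$. Then $\mathcal D$ has codimension $2$ in $\mathcal N$, in the following sense: there is a nonempty relatively open subset $\mathcal M$ of $\mathcal D$ that is a smooth embedded submanifold of $\mathcal N$ with $$\dim\mathcal N-\dim\mathcal M=2,$$ and the exceptional set $\mathcal D\setminus\mathcal M$ is either empty or of Hausdorff dimension strictly less than $\dim\mathcal M=\dim\mathcal N-2$. If moreover $n\ge 3$, then the same is true of the derogatory matrices whose bandwidth $\max\{|i-j| : a_{ij}\neq 0\}$ is exactly $k$ (these lie in the open subset of $\mathcal N$ of matrices of bandwidth exactly $k$): they have codimension $2$ in the same sense. -/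

import Mathlib

open scoped ContDiff ENNReal

/- Matrices carry the entrywise sup norm.  All norms on a finite-dimensional real vector space are
equivalent, so smoothness and Hausdorff dimension do not depend on this choice. -/
attribute [local instance] Matrix.normedAddCommGroup Matrix.normedSpace

/-- A square matrix is derogatory if one of its eigenvalues has geometric multiplicity greater
than one.  (All complex eigenvalues of a real symmetric matrix are real, so for those matrices it
is enough to look at real eigenvalues.) -/
def IsDerogatory {K : Type*} [Field K] {n : ℕ} (A : Matrix (Fin n) (Fin n) K) : Prop :=
  ∃ μ : K, 1 < Module.finrank K (Module.End.eigenspace (Matrix.toLin' A) μ)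

open Classical in
/-- The bandwidth `max {|j - i| : A i j ≠ 0}` (and `0` for the zero matrix). -/
noncomputable def bandwidth {K : Type*} [Zero K] {n : ℕ} (A : Matrix (Fin n) (Fin n) K) : ℕ :=
  (Finset.univ.filter fun p : Fin n × Fin n => A p.1 p.2 ≠ 0).sup
    fun p => ((p.2 : ℤ) - (p.1 : ℤ)).natAbs

theorem bandwidth_le_iff {K : Type*} [Zero K] {n : ℕ} (A : Matrix (Fin n) (Fin n) K) (k : ℕ) :
    bandwidth A ≤ k ↔ ∀ i j : Fin n, k < ((j : ℤ) - (i : ℤ)).natAbs → A i j = 0 := by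
  classical
  simp only [bandwidth, Finset.sup_le_iff, Finset.mem_filter, Finset.mem_univ, true_and,
    Prod.forall]
  refine forall_congr' fun i => forall_congr' fun j => ?_
  rw [← not_lt, not_imp_not]

/-- The manifold of real symmetric `n × n` matrices of bandwidth (at most) `k`: a linear subspace
of the space of all matrices. -/
def bandedSymm (n k : ℕ) : Submodule ℝ (Matrix (Fin n) (Fin n) ℝ) where
  carrier := {A | A.IsSymm ∧ bandwidth A ≤ k}
  zero_mem' := ⟨Matrix.isSymm_zero, (bandwidth_le_iff _ _).2 fun _ _ _ => rfl⟩
  add_mem' := by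
    rintro A B ⟨hA, hA'⟩ ⟨hB, hB'⟩
    rw [bandwidth_le_iff] at hA' hB'
    refine ⟨hA.add hB, (bandwidth_le_iff _ _).2 fun i j h => ?_⟩
    rw [Matrix.add_apply, hA' i j h, hB' i j h, add_zero]
  smul_mem' := by
    rintro c A ⟨hA, hA'⟩
    rw [bandwidth_le_iff] at hA'
    refine ⟨hA.smul c, (bandwidth_le_iff _ _).2 fun i j h => ?_⟩
    rw [Matrix.smul_apply, hA' i j h, smul_zero]

/-- `M` is a smooth embedded submanifold of dimension `d` of the vector space `E`: around each of
its points there is a smooth chart of `E` that straightens `M` to a linear subspace of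
dimension `d`. -/
def IsEmbeddedSubmanifold {E : Type*} [NormedAddCommGroup E] [NormedSpace ℝ E]
    (d : ℕ) (M : Set E) : Prop :=
  ∀ x ∈ M, ∃ (φ : OpenPartialHomeomorph E E) (L : Submodule ℝ E),
    x ∈ φ.source ∧ ContDiffOn ℝ ∞ φ φ.source ∧ ContDiffOn ℝ ∞ φ.symm φ.target ∧
      Module.finrank ℝ L = d ∧ φ '' (φ.source ∩ M) = φ.target ∩ (L : Set E)

/-- `D` has codimension `c` in the finite-dimensional space `E`: apart from a relatively closed
exceptional subset of smaller dimension, `D` is a nonempty smooth embedded submanifold `M` of `E`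
with `dim E - dim M = c`. The exceptional subset is empty if `D` itself is a submanifold. -/
def HasCodimension {E : Type*} [NormedAddCommGroup E] [NormedSpace ℝ E]
    (D : Set E) (c : ℕ) : Prop :=
  ∃ (d : ℕ) (V : Set E), IsOpen V ∧ (D ∩ V).Nonempty ∧ IsEmbeddedSubmanifold d (D ∩ V) ∧
    Module.finrank ℝ E = d + c ∧ ((D \ V).Nonempty → dimH (D \ V) < (d : ℝ≥0∞))

/-!
Count the eigenvalues `μ` of `A` together with eigenvectors as solutions of `A v = μ v`, normalized
by prescribing coordinates of `v`. If `M` is the eigenspace of a double eigenvalue, then `A` can be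
moved within the space `S` of banded matrices so that its compression `xᵀ H y` to `M` is any
symmetric form, provided that for any two nonzero `x, y` in `M` some `H` in `S` has `xᵀ H y ≠ 0`
(`S` separates `M`). Staying derogatory means that this compression stays scalar, which is two
conditions; eliminating `μ` then presents the derogatory matrices near `A` as the zeros of two
equations with independent derivatives.

The remaining derogatory matrices have an eigenspace that `S` does not separate, or an eigenspace
of dimension at least three, or two multiple eigenvalues. Each case is the projection of a set of
solutions `(A, μ, v)` at which the tangent space has dimension at most `dim S - 3`, so it has
Hausdorff dimension at most `dim S - 3`. If `S` does not separate `x, y`, then `x` and `y`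
have disjoint, non-adjacent supports, and connectedness of the graph of the band gives two extra
edges leaving the supports, which supply the missing conditions.
-/

open Topology Set Module
open scoped Matrix

section Submanifold

variable {X Y N : Type*} [NormedAddCommGroup X] [NormedSpace ℝ X] [NormedAddCommGroup Y]
  [NormedSpace ℝ Y] [NormedAddCommGroup N] [NormedSpace ℝ N]

theorem exists_generalizedInverse {K V W : Type*} [Field K] [AddCommGroup V] [Module K V]
    [AddCommGroup W] [Module K W] (L : V →ₗ[K] W) : ∃ σ : W →ₗ[K] V, ∀ z, L (σ (L z)) = L z := by
  obtain ⟨P, hP⟩ := (LinearMap.range L).subtype.exists_leftInverse_of_injective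
    (LinearMap.range L).ker_subtype
  obtain ⟨s, hs⟩ := L.rangeRestrict.exists_rightInverse_of_surjective L.range_rangeRestrict
  refine ⟨s ∘ₗ P, fun z => ?_⟩
  have hPz : P (L z) = L.rangeRestrict z := LinearMap.congr_fun hP (L.rangeRestrict z)
  have hsz : L.rangeRestrict (s (P (L z))) = P (L z) := LinearMap.congr_fun hs (P (L z))
  exact congrArg Subtype.val (hsz.trans hPz)

theorem exists_chart_fderiv_apply_eq [FiniteDimensional ℝ X] [FiniteDimensional ℝ Y]
    {F : X → Y} {p : X} {n : ℕ∞ω} (hF : ContDiffAt ℝ n F p) (hn : n ≠ 0) (hn' : n ≠ (∞ : ℕ∞ω)) :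
    ∃ φ : OpenPartialHomeomorph X X, p ∈ φ.source ∧ ContDiffOn ℝ n φ φ.source ∧
      ContDiffOn ℝ n φ.symm φ.target ∧
      ∀ z, F z ∈ (fderiv ℝ F p).range → fderiv ℝ F p (φ z) = F z := by
  set L := fderiv ℝ F p
  obtain ⟨σ, hσ⟩ := exists_generalizedInverse (L : X →ₗ[ℝ] Y)
  let Θ : X → X := fun z => z + σ.toContinuousLinearMap (F z - L z)
  have hΘ : ContDiffAt ℝ n Θ p := contDiffAt_id.add
    (σ.toContinuousLinearMap.contDiff.contDiffAt.comp p (hF.sub L.contDiff.contDiffAt))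
  have hΘ' : HasFDerivAt Θ ((ContinuousLinearEquiv.refl ℝ X : X ≃L[ℝ] X) : X →L[ℝ] X) p := by
    have hsub : HasFDerivAt (fun z => F z - L z) (L - L) p :=
      (hF.differentiableAt hn).hasFDerivAt.sub L.hasFDerivAt
    convert! (hasFDerivAt_id p).add (σ.toContinuousLinearMap.hasFDerivAt.comp p hsub) using 1
    ext z
    simp
  let φ := hΘ.toOpenPartialHomeomorph Θ hΘ' hn
  refine ⟨φ.restrContDiff ℝ n hn', ⟨hΘ.mem_toOpenPartialHomeomorph_source hΘ' hn, hΘ,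
    hΘ.to_localInverse hΘ' hn⟩, φ.contDiffOn_restrContDiff_source ℝ hn',
    φ.contDiffOn_restrContDiff_target ℝ hn', ?_⟩
  rintro z ⟨y, hy⟩
  change L (z + σ (F z - L z)) = F z
  have hσF : L (σ (F z)) = F z := by
    rw [← hy]
    exact hσ y
  have hσL : L (σ (L z)) = L z := hσ z
  rw [map_add, map_sub, map_sub, hσF, hσL, add_sub_cancel]

theorem dimH_submodule [FiniteDimensional ℝ X] (K : Submodule ℝ X) :
    dimH (K : Set X) = finrank ℝ K := by
  rw [← Real.dimH_univ_eq_finrank K, ← (isometry_subtype_coe (s := (K : Set X))).dimH_image,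
    image_univ, Subtype.range_coe]

theorem exists_mem_nhds_dimH_zeroSet_le [FiniteDimensional ℝ X] [FiniteDimensional ℝ Y]
    {F : X → Y} {p : X} (hF : ContDiffAt ℝ 1 F p) :
    ∃ W ∈ 𝓝 p, dimH (W ∩ {z | F z = 0}) ≤ finrank ℝ (fderiv ℝ F p).ker := by
  obtain ⟨φ, hp, -, hφ', hL⟩ := exists_chart_fderiv_apply_eq hF one_ne_zero (by simp)
  obtain ⟨C, t, ht, hlip⟩ := (hφ'.contDiffAt (φ.open_target.mem_nhds
    (φ.map_source hp))).exists_lipschitzOnWith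
  refine ⟨φ.source ∩ φ ⁻¹' t, Filter.inter_mem (φ.open_source.mem_nhds hp)
    ((φ.continuousAt hp).preimage_mem_nhds ht), ?_⟩
  have hsub : (φ.source ∩ φ ⁻¹' t) ∩ {z | F z = 0} ⊆
      φ.symm '' (t ∩ ((fderiv ℝ F p).ker : Set X)) := by
    rintro z ⟨⟨hz, hzt⟩, hz0 : F z = 0⟩
    refine ⟨φ z, ⟨hzt, ?_⟩, φ.left_inv hz⟩
    change fderiv ℝ F p (φ z) = 0
    rw [hL z (hz0 ▸ Submodule.zero_mem _), hz0]
  calc dimH ((φ.source ∩ φ ⁻¹' t) ∩ {z | F z = 0})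
      ≤ dimH (φ.symm '' (t ∩ ((fderiv ℝ F p).ker : Set X))) := dimH_mono hsub
    _ ≤ dimH (t ∩ ((fderiv ℝ F p).ker : Set X)) :=
        (hlip.mono inter_subset_left).dimH_image_le
    _ ≤ dimH ((fderiv ℝ F p).ker : Set X) := dimH_mono inter_subset_right
    _ = _ := dimH_submodule _

theorem dimH_image_le_of_finrank_ker_fderiv_le [FiniteDimensional ℝ X] [FiniteDimensional ℝ Y]
    {F : X → Y} (hF : ContDiff ℝ 1 F) (f : X →L[ℝ] N) {T : Set X} {m : ℕ}
    (hT : ∀ p ∈ T, F p = 0 ∧ finrank ℝ (fderiv ℝ F p).ker ≤ m) : dimH (f '' T) ≤ m := by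
  refine (f.lipschitz.dimH_image_le T).trans (not_lt.1 fun hlt => ?_)
  obtain ⟨p, hp, hlocal⟩ := exists_mem_nhdsWithin_lt_dimH_of_lt_dimH hlt
  obtain ⟨W, hW, hd⟩ := exists_mem_nhds_dimH_zeroSet_le (hF.contDiffAt (x := p))
  refine (hlocal (W ∩ T) (Filter.inter_mem (mem_nhdsWithin_of_mem_nhds hW)
    self_mem_nhdsWithin)).not_ge ?_
  calc dimH (W ∩ T) ≤ dimH (W ∩ {z | F z = 0}) :=
        dimH_mono (inter_subset_inter_right _ fun q hq => (hT q hq).1)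
    _ ≤ finrank ℝ (fderiv ℝ F p).ker := hd
    _ ≤ m := by exact_mod_cast (hT p hp).2

/-- The set `M` straightens near `x` to a `d`-dimensional linear subspace. This is the local
condition in `IsEmbeddedSubmanifold`, except that `x` need not belong to `M`. -/
def IsSubmanifoldAt (d : ℕ) (M : Set X) (x : X) : Prop :=
  ∃ (φ : OpenPartialHomeomorph X X) (L : Submodule ℝ X),
    x ∈ φ.source ∧ ContDiffOn ℝ ∞ φ φ.source ∧ ContDiffOn ℝ ∞ φ.symm φ.target ∧
      finrank ℝ L = d ∧ φ '' (φ.source ∩ M) = φ.target ∩ (L : Set X)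

theorem isOpen_setOf_isSubmanifoldAt (d : ℕ) (M : Set X) : IsOpen {x | IsSubmanifoldAt d M x} :=
  isOpen_iff_mem_nhds.2 fun _ ⟨φ, L, hx, h⟩ =>
    Filter.mem_of_superset (φ.open_source.mem_nhds hx) fun _ hy => ⟨φ, L, hy, h⟩

theorem IsSubmanifoldAt.congr {d : ℕ} {M M' : Set X} {x : X} (h : IsSubmanifoldAt d M x)
    (hM : ∀ᶠ z in 𝓝 x, z ∈ M' ↔ z ∈ M) : IsSubmanifoldAt d M' x := by
  obtain ⟨φ, L, hx, hφ, hφ', hL, him⟩ := h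
  obtain ⟨U, hU, hUo, hxU⟩ := mem_nhds_iff.1 hM
  have htarget : (φ.restrOpen U hUo).target = φ.target ∩ φ.symm ⁻¹' U := rfl
  refine ⟨φ.restrOpen U hUo, L, ⟨hx, hxU⟩, hφ.mono inter_subset_left, hφ'.mono inter_subset_left,
    hL, ?_⟩
  rw [htarget, φ.restrOpen_source, inter_right_comm φ.target, ← him]
  ext w
  constructor
  · rintro ⟨z, ⟨⟨hz, hzU⟩, hzM⟩, rfl⟩
    refine ⟨⟨z, ⟨hz, (hU hzU).1 hzM⟩, rfl⟩, ?_⟩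
    change φ.symm (φ z) ∈ U
    rwa [φ.left_inv hz]
  · rintro ⟨⟨z, ⟨hz, hzM⟩, rfl⟩, hzU⟩
    rw [mem_preimage, φ.left_inv hz] at hzU
    exact ⟨z, ⟨⟨hz, hzU⟩, (hU hzU).2 hzM⟩, rfl⟩

theorem isSubmanifoldAt_zeroSet_of_surjective_fderiv [FiniteDimensional ℝ X]
    [FiniteDimensional ℝ Y] {x : X} {h : X → Y} {d : ℕ} (hh : ContDiffAt ℝ ω h x)
    (hsurj : Function.Surjective (fderiv ℝ h x)) (hd : finrank ℝ X = d + finrank ℝ Y) :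
    IsSubmanifoldAt d {z | h z = 0} x := by
  obtain ⟨φ, hx, hφ, hφ', hL⟩ := exists_chart_fderiv_apply_eq hh (by simp) (by simp)
  have hrange : (fderiv ℝ h x).range = ⊤ := LinearMap.range_eq_top.2 hsurj
  have hφh (z : X) : φ z ∈ (fderiv ℝ h x).ker ↔ h z = 0 := by
    rw [← hL z (hrange ▸ Submodule.mem_top)]
    rfl
  refine ⟨φ, (fderiv ℝ h x).ker, hx, hφ.of_le (by simp), hφ'.of_le (by simp), ?_, ?_⟩
  · have := (fderiv ℝ h x : X →ₗ[ℝ] Y).finrank_range_add_finrank_ker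
    rw [hrange, finrank_top] at this
    omega
  · ext w
    constructor
    · rintro ⟨z, ⟨hz, hz0⟩, rfl⟩
      exact ⟨φ.map_source hz, (hφh z).2 hz0⟩
    · rintro ⟨hw, hwL⟩
      refine ⟨φ.symm w, ⟨φ.map_target hw, (hφh _).1 ?_⟩, φ.right_inv hw⟩
      rwa [φ.right_inv hw]

theorem hasCodimension_inter_of_dimH_lt {d c : ℕ} {D Ω : Set X} (hΩ : IsOpen Ω)
    (hc : finrank ℝ X = d + c) {x : X} (hx : x ∈ D ∩ Ω) (hxD : IsSubmanifoldAt d D x)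
    (hdim : dimH {z ∈ D | ¬ IsSubmanifoldAt d D z} < d) : HasCodimension (D ∩ Ω) c := by
  refine ⟨d, {z | IsSubmanifoldAt d D z}, isOpen_setOf_isSubmanifoldAt d D, ⟨x, hx, hxD⟩, ?_, hc,
    fun _ => (dimH_mono ?_).trans_lt hdim⟩
  · rintro z ⟨⟨-, hzΩ⟩, hz⟩
    refine hz.congr ?_
    filter_upwards [(isOpen_setOf_isSubmanifoldAt d D).mem_nhds hz, hΩ.mem_nhds hzΩ] with y hy hyΩ
    exact ⟨fun h => h.1.1, fun h => ⟨⟨h, hyΩ⟩, hy⟩⟩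
  · exact fun z hz => ⟨hz.1.1, hz.2⟩

end Submanifold

section PivotSet

variable {F ι : Type*} [Field F]

/-- `P` is a set of pivots of the subspace `K` if the coordinates in `P` form a coordinate system
of `K`, that is, a vector of `K` can be prescribed freely and uniquely on `P`. -/
def IsPivotSet (P : Finset ι) (K : Submodule F (ι → F)) : Prop :=
  Function.Bijective (LinearMap.funLeft F F ((↑) : P → ι) ∘ₗ K.subtype)

namespace IsPivotSet

variable {P : Finset ι} {K : Submodule F (ι → F)}

theorem finrank_eq (h : IsPivotSet P K) : finrank F K = P.card := by
  rw [(LinearEquiv.ofBijective _ h).finrank_eq, finrank_fintype_fun_eq_card, Fintype.card_coe]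

theorem eq_zero (h : IsPivotSet P K) {w : ι → F} (hw : w ∈ K) (hP : ∀ p ∈ P, w p = 0) : w = 0 :=
  congrArg Subtype.val (h.1 (a₁ := ⟨w, hw⟩) (a₂ := 0) (funext fun p => hP p p.2))

theorem exists_eq_on (h : IsPivotSet P K) (c : P → F) : ∃ w ∈ K, ∀ p : P, w p = c p := by
  obtain ⟨w, hw⟩ := h.2 c
  exact ⟨w, w.2, congrFun hw⟩

theorem eq_of_eq_on (h : IsPivotSet P K) {w z : ι → F} (hw : w ∈ K) (hz : z ∈ K)
    (hP : ∀ p ∈ P, w p = z p) : w = z :=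
  sub_eq_zero.1 (h.eq_zero (K.sub_mem hw hz) fun p hp => sub_eq_zero.2 (hP p hp))

theorem eq_sum [DecidableEq ι] (h : IsPivotSet P K) {v : P → ι → F} (hv : ∀ p, v p ∈ K)
    (hdual : ∀ p q : P, v p q = (Pi.single p 1 : P → F) q) {w : ι → F} (hw : w ∈ K) :
    w = ∑ p : P, w p • v p := by
  refine h.eq_of_eq_on hw (K.sum_mem fun p _ => K.smul_mem _ (hv p)) fun q hq => ?_
  simp [Finset.sum_apply, hdual _ ⟨q, hq⟩, Pi.single_apply]

end IsPivotSet

theorem exists_isPivotSet [Finite ι] (K : Submodule F (ι → F)) :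
    ∃ P : Finset ι, IsPivotSet P K := by
  classical
  cases nonempty_fintype ι
  obtain ⟨P, hP, hmin⟩ := exists_minimal_of_wellFoundedLT
    (fun P : Finset ι => ∀ w ∈ K, (∀ p ∈ P, w p = 0) → w = 0)
    ⟨Finset.univ, fun w _ hw => funext fun p => hw p (Finset.mem_univ p)⟩
  have hdual (p : P) : ∃ v ∈ K, ∀ q : P, v q = (Pi.single p 1 : P → F) q := by
    by_contra! hno
    refine absurd (hmin (y := P.erase p) (fun w hw hwp => ?_) (P.erase_subset ↑p) p.2)
      (P.notMem_erase ↑p)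
    refine hP w hw fun q hq => by_contra fun hwq => ?_
    have hwq' (q : P) (hqp : q ≠ p) : w q = 0 :=
      hwp q (Finset.mem_erase.2 ⟨fun h => hqp (Subtype.ext h), q.2⟩)
    have hqp : q = p := by_contra fun h => hwq (hwp q (Finset.mem_erase.2 ⟨h, hq⟩))
    subst hqp
    obtain ⟨q, hq⟩ := hno ((w p)⁻¹ • w) (K.smul_mem _ hw)
    refine hq ?_
    obtain rfl | hqp := eq_or_ne q p
    · simp [hwq]
    · simp [hwq' q hqp, hqp]
  choose v hvK hv using hdual
  refine ⟨P, (injective_iff_map_eq_zero _).2 fun w hw => ?_, fun c => ?_⟩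
  · exact Subtype.ext (hP w w.2 fun p hp => congrFun hw ⟨p, hp⟩)
  · refine ⟨⟨∑ p, c p • v p, K.sum_mem fun p _ => K.smul_mem _ (hvK p)⟩, funext fun q => ?_⟩
    change (∑ p, c p • v p) (q : ι) = c q
    simp [Finset.sum_apply, hv, Pi.single_apply]

end PivotSet

section Incidence

variable {ι E J : Type*} [Fintype ι]

/-- The eigenspace of the matrix `A` for `μ`, as a space of functions `ι → ℝ`. -/
abbrev eigenspaceOf [DecidableEq ι] (A : Matrix ι ι ℝ) (μ : ℝ) : Submodule ℝ (ι → ℝ) :=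
  Module.End.eigenspace (Matrix.toLin' A) μ

theorem mem_eigenspaceOf [DecidableEq ι] {A : Matrix ι ι ℝ} {μ : ℝ} {w : ι → ℝ} :
    w ∈ eigenspaceOf A μ ↔ A.mulVec w = μ • w := by
  rw [Module.End.mem_eigenspace_iff, Matrix.toLin'_apply]

variable (S : Submodule ℝ (Matrix ι ι ℝ)) (π : J → E)

/-- The bilinear map whose diagonal `p ↦ eigenResidual S π p p` vanishes at `p = (A, μ, v)` exactly
if every `v j` is an eigenvector (or zero) of `A` for `μ (π j)`. -/
def eigenResidual :
    S × (E → ℝ) × (J → ι → ℝ) →ₗ[ℝ] S × (E → ℝ) × (J → ι → ℝ) →ₗ[ℝ] J → ι → ℝ :=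
  LinearMap.mk₂ ℝ (fun p q j => p.1.1.mulVec (q.2.2 j) - p.2.1 (π j) • q.2.2 j)
    (fun p p' q => funext fun j => by
      simp only [Prod.fst_add, Prod.snd_add, Submodule.coe_add, Matrix.add_mulVec, Pi.add_apply,
        add_smul]
      abel)
    (fun c p q => funext fun j => by
      simp [Matrix.smul_mulVec, mul_smul, smul_sub])
    (fun p q q' => funext fun j => by
      simp only [Prod.snd_add, Pi.add_apply, Matrix.mulVec_add, smul_add]
      abel)
    (fun c p q => funext fun j => by
      simp [Matrix.mulVec_smul, smul_sub, smul_comm c])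

/-- Restriction of a family of vectors to prescribed sets `C j` of coordinates. -/
def restrictCoords (C : J → Finset ι) :
    S × (E → ℝ) × (J → ι → ℝ) →ₗ[ℝ] (j : J) → C j → ℝ :=
  LinearMap.pi fun j => LinearMap.funLeft ℝ ℝ ((↑) : C j → ι) ∘ₗ LinearMap.proj j ∘ₗ
    LinearMap.snd ℝ (E → ℝ) (J → ι → ℝ) ∘ₗ LinearMap.snd ℝ S ((E → ℝ) × (J → ι → ℝ))

/-- The tangent space at `p = (A, μ, v)` of the incidence variety of all matrices in `S` with
eigenvalues `μ` and eigenvectors `v`, where the coordinates in `C j` of `v j` are kept fixed. -/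
def incidenceTangent (C : J → Finset ι) (p : S × (E → ℝ) × (J → ι → ℝ)) :
    Submodule ℝ (S × (E → ℝ) × (J → ι → ℝ)) :=
  LinearMap.ker (eigenResidual S π p + (eigenResidual S π).flip p) ⊓
    LinearMap.ker (restrictCoords S C)

variable {S π}

theorem mem_incidenceTangent {C : J → Finset ι} {A H : S} {μ s : E → ℝ} {v w : J → ι → ℝ} :
    (H, s, w) ∈ incidenceTangent S π C (A, μ, v) ↔
      (∀ j, A.1.mulVec (w j) + H.1.mulVec (v j) = μ (π j) • w j + s (π j) • v j) ∧
        ∀ j, ∀ l ∈ C j, w j l = 0 := by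
  have hres : (eigenResidual S π (A, μ, v) + (eigenResidual S π).flip (A, μ, v)) (H, s, w) =
      fun j => A.1.mulVec (w j) + H.1.mulVec (v j) - (μ (π j) • w j + s (π j) • v j) :=
    funext fun j => sub_add_sub_comm _ _ _ _
  refine and_congr ((congrArg (· = 0) hres).to_iff.trans
    (funext_iff.trans (forall_congr' fun j => sub_eq_zero))) ?_
  exact ⟨fun h j l hl => congrFun (congrFun h j) ⟨l, hl⟩,
    fun h => funext fun j => funext fun l => h j l l.2⟩

theorem dimH_setOf_exists_incidence_le [Finite E] [Finite J] (C : J → Finset ι)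
    (b : J → ι → ℝ) (m : ℕ) :
    dimH {A : S | ∃ (μ : E → ℝ) (v : J → ι → ℝ), (∀ j, A.1.mulVec (v j) = μ (π j) • v j) ∧
      (∀ j, ∀ l ∈ C j, v j l = b j l) ∧
      finrank ℝ (incidenceTangent S π C (A, μ, v)) ≤ m} ≤ m := by
  cases nonempty_fintype E
  cases nonempty_fintype J
  let B := (eigenResidual S π).toContinuousBilinearMap
  let R := (restrictCoords (E := E) S C).toContinuousLinearMap
  let F := fun p => (B p p, R p - R (0, 0, b))
  have hF : ContDiff ℝ 1 F :=
    (B.contDiff.clm_apply contDiff_id).prodMk (R.contDiff.sub contDiff_const)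
  have hker p : (fderiv ℝ F p).ker = incidenceTangent S π C p := by
    have hF' := ((B.hasFDerivAt (x := p)).clm_apply (hasFDerivAt_id p)).prodMk
      (R.hasFDerivAt.sub_const (R (0, 0, b)))
    have hF'' : fderiv ℝ F p = _ := hF'.fderiv
    rw [hF'']
    ext q
    exact Prod.mk_eq_zero
  refine (dimH_mono ?_).trans (dimH_image_le_of_finrank_ker_fderiv_le hF
    (ContinuousLinearMap.fst ℝ S ((E → ℝ) × (J → ι → ℝ)))
    (T := {p | F p = 0 ∧ finrank ℝ (incidenceTangent S π C p) ≤ m})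
    fun p hp => ⟨hp.1, (hker p) ▸ hp.2⟩)
  rintro A ⟨μ, v, hAv, hb, hm⟩
  refine ⟨(A, μ, v), ⟨Prod.mk_eq_zero.2 ⟨?_, ?_⟩, hm⟩, rfl⟩
  · exact funext fun j => sub_eq_zero.2 (hAv j)
  · exact funext fun j => funext fun l => sub_eq_zero.2 (hb j l l.2)

end Incidence

section Compression

variable {ι : Type*} [Fintype ι]

theorem finrank_add_finrank_le_of_mem_imp_eq_zero {K V Z : Type*} [Field K] [AddCommGroup V]
    [Module K V] [FiniteDimensional K V] [AddCommGroup Z] [Module K Z] {T : Submodule K V}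
    (j : Z →ₗ[K] V) (hj : ∀ z, j z ∈ T → z = 0) :
    finrank K T + finrank K Z ≤ finrank K V := by
  have hinj : Function.Injective (T.mkQ ∘ₗ j) := (injective_iff_map_eq_zero _).2 fun z hz =>
    hj z ((Submodule.Quotient.mk_eq_zero T).1 hz)
  have := LinearMap.finrank_le_finrank_of_injective hinj
  have := T.finrank_quotient_add_finrank
  omega

theorem dotProduct_mulVec_comm_of_isSymm {R : Type*} [CommSemiring R] {A : Matrix ι ι R}
    (hA : A.IsSymm) (x y : ι → R) : x ⬝ᵥ A *ᵥ y = y ⬝ᵥ A *ᵥ x := by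
  rw [Matrix.dotProduct_mulVec, ← Matrix.mulVec_transpose, hA.eq, dotProduct_comm]

theorem dotProduct_mulVec_of_mem_eigenspaceOf [DecidableEq ι] {A : Matrix ι ι ℝ} (hA : A.IsSymm)
    {μ : ℝ} {x : ι → ℝ} (hx : x ∈ eigenspaceOf A μ) (y : ι → ℝ) :
    x ⬝ᵥ A *ᵥ y = μ * (x ⬝ᵥ y) := by
  rw [dotProduct_mulVec_comm_of_isSymm hA, mem_eigenspaceOf.1 hx, dotProduct_smul, smul_eq_mul,
    dotProduct_comm]

variable (S : Submodule ℝ (Matrix ι ι ℝ)) (M : Submodule ℝ (ι → ℝ))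

/-- The matrices in `S` whose compression to `M` (as a bilinear form) vanishes. -/
def zeroCompression : Submodule ℝ S where
  carrier := {H | ∀ x ∈ M, ∀ y ∈ M, x ⬝ᵥ H.1 *ᵥ y = 0}
  zero_mem' x _ y _ := by simp
  add_mem' {H H'} hH hH' x hx y hy := by
    simp [Matrix.add_mulVec, dotProduct_add, hH x hx y hy, hH' x hx y hy]
  smul_mem' c H hH x hx y hy := by simp [Matrix.smul_mulVec, dotProduct_smul, hH x hx y hy]

/-- The matrices in `S` whose compression to `M` (as a bilinear form) is a multiple of the
identity. -/
def scalarCompression : Submodule ℝ S where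
  carrier := {H | ∃ s : ℝ, ∀ x ∈ M, ∀ y ∈ M, x ⬝ᵥ H.1 *ᵥ y = s * (x ⬝ᵥ y)}
  zero_mem' := ⟨0, fun x _ y _ => by simp⟩
  add_mem' {H H'} := fun ⟨s, hs⟩ ⟨s', hs'⟩ => ⟨s + s', fun x hx y hy => by
    simp [Matrix.add_mulVec, dotProduct_add, hs x hx y hy, hs' x hx y hy, add_mul]⟩
  smul_mem' c H := fun ⟨s, hs⟩ => ⟨c * s, fun x hx y hy => by
    simp [Matrix.smul_mulVec, dotProduct_smul, hs x hx y hy, mul_assoc]⟩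

/-- For any two nonzero vectors of `M`, some matrix in `S` pairs them nontrivially. This makes the
compression of `S` to `M` as large as needed for an eigenvalue with eigenspace `M` to be split
generically. -/
def SeparatesPairs : Prop :=
  ∀ x ∈ M, ∀ y ∈ M, x ≠ 0 → y ≠ 0 → ∃ H ∈ S, x ⬝ᵥ H *ᵥ y ≠ 0

variable {S M}

theorem finrank_scalarCompression_le (hM : M ≠ ⊥) :
    finrank ℝ (scalarCompression S M) ≤ finrank ℝ (zeroCompression S M) + 1 := by
  obtain ⟨x, hx, hx0⟩ := M.exists_mem_ne_zero_of_ne_bot hM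
  let q : scalarCompression S M →ₗ[ℝ] ℝ :=
    { toFun := fun H => x ⬝ᵥ H.1.1 *ᵥ x
      map_add' := fun H H' => by simp [Matrix.add_mulVec, dotProduct_add]
      map_smul' := fun c H => by simp [Matrix.smul_mulVec, dotProduct_smul] }
  have hker : (LinearMap.ker q).map (scalarCompression S M).subtype ≤ zeroCompression S M := by
    rintro _ ⟨⟨H, s, hs⟩, hH, rfl⟩ y hy z hz
    have hs0 : s = 0 := by
      have : s * (x ⬝ᵥ x) = 0 := (hs x hx x hx).symm.trans hH
      exact (mul_eq_zero.1 this).resolve_right (dotProduct_self_eq_zero.not.2 hx0)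
    exact (hs y hy z hz).trans (by rw [hs0, zero_mul])
  have hrange := (LinearMap.range q).finrank_le
  have hle := Submodule.finrank_mono hker
  rw [Submodule.finrank_map_subtype_eq] at hle
  have := LinearMap.finrank_range_add_finrank_ker (K := ℝ) (V := scalarCompression S M) q
  rw [finrank_self] at hrange
  omega

theorem dotProduct_diagonal_extend_mulVec [DecidableEq ι] {P : Finset ι} {v : P → ι → ℝ}
    (hv : ∀ p q : P, v p q = (Pi.single p 1 : P → ℝ) q) (c : P → ℝ) (p q : P) :
    v p ⬝ᵥ Matrix.diagonal (Function.extend Subtype.val c 0) *ᵥ v q = if p = q then c p else 0 := by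
  rw [dotProduct, Finset.sum_eq_single (p : ι)]
  · rw [Matrix.mulVec_diagonal, Subtype.val_injective.extend_apply, hv, hv]
    simp [Pi.single_apply]
  · intro l _ hl
    by_cases hlP : l ∈ P
    · rw [hv p ⟨l, hlP⟩, Pi.single_eq_of_ne (fun h => hl (congrArg Subtype.val h)), zero_mul]
    · rw [Matrix.mulVec_diagonal, Function.extend_apply' _ _ _ (by simpa using hlP)]
      simp
  · simp

theorem finrank_zeroCompression_add_le [DecidableEq ι] (hdiag : ∀ d, Matrix.diagonal d ∈ S)
    (hM : 2 ≤ finrank ℝ M) (hsep : SeparatesPairs S M) :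
    finrank ℝ (zeroCompression S M) + (finrank ℝ M + 1) ≤ finrank ℝ S := by
  obtain ⟨P, hP⟩ := exists_isPivotSet M
  rw [hP.finrank_eq] at hM ⊢
  obtain ⟨i, hi, j, hj, hij⟩ := Finset.one_lt_card.1 hM
  choose v hvM hv using fun p : P => hP.exists_eq_on (Pi.single p 1)
  have hv0 (p : P) : v p ≠ 0 := fun h => by simpa [h] using hv p p
  obtain ⟨H₀, hH₀, hne⟩ := hsep _ (hvM ⟨i, hi⟩) _ (hvM ⟨j, hj⟩) (hv0 _) (hv0 _)
  let D : (P → ℝ) →ₗ[ℝ] S := (Matrix.diagonalLinearMap ι ℝ ℝ).codRestrict S hdiag ∘ₗ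
    Function.ExtendByZero.linearMap ℝ (Subtype.val : P → ι)
  have hD (c : P → ℝ) (p q : P) : v p ⬝ᵥ (D c).1 *ᵥ v q = if p = q then c p else 0 :=
    dotProduct_diagonal_extend_mulVec hv c p q
  have := finrank_add_finrank_le_of_mem_imp_eq_zero (T := zeroCompression S M)
    (D.coprod (LinearMap.toSpanSingleton ℝ S ⟨H₀, hH₀⟩)) ?_
  · simpa using this
  rintro ⟨c, t⟩ hct
  have hpair (p q : P) : (if p = q then c p else 0) + t * (v p ⬝ᵥ H₀ *ᵥ v q) = 0 := by
    rw [← hD, ← smul_eq_mul, ← dotProduct_smul, ← Matrix.smul_mulVec, ← dotProduct_add,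
      ← Matrix.add_mulVec]
    exact hct _ (hvM p) _ (hvM q)
  have ht : t = 0 := by
    have := hpair ⟨i, hi⟩ ⟨j, hj⟩
    rw [if_neg (fun h => hij (congrArg Subtype.val h)), zero_add] at this
    exact (mul_eq_zero.1 this).resolve_right hne
  refine Prod.ext (funext fun p => ?_) ht
  simpa [ht] using hpair p p

theorem finrank_scalarCompression_add_le [DecidableEq ι] (hdiag : ∀ d, Matrix.diagonal d ∈ S)
    (hM : 2 ≤ finrank ℝ M) (hsep : SeparatesPairs S M) :
    finrank ℝ (scalarCompression S M) + finrank ℝ M ≤ finrank ℝ S := by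
  have hM0 : M ≠ ⊥ := by
    rintro rfl
    simp at hM
  have := finrank_scalarCompression_le (S := S) hM0
  have := finrank_zeroCompression_add_le hdiag hM hsep
  omega

variable {E : Type*} [DecidableEq ι]

theorem finrank_incidenceTangent_le_scalarCompression {A : S} (hA : A.1.IsSymm) {μ : E → ℝ}
    (hμ : ∀ e, eigenspaceOf A.1 (μ e) ≠ ⊥) {P : E → Finset ι}
    (hP : ∀ e, IsPivotSet (P e) (eigenspaceOf A.1 (μ e))) {v : (Σ e, P e) → ι → ℝ}
    (hv : ∀ j, v j ∈ eigenspaceOf A.1 (μ j.1))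
    (hdual : ∀ j, ∀ q : P j.1, v j q = (Pi.single j.2 1 : P j.1 → ℝ) q) :
    finrank ℝ (incidenceTangent S Sigma.fst (fun j => P j.1) (A, μ, v)) ≤
      finrank ℝ (⨅ e, scalarCompression S (eigenspaceOf A.1 (μ e)) : Submodule ℝ S) := by
  have hscalar {H : S} {s : E → ℝ} {w : (Σ e, P e) → ι → ℝ}
      (h : (H, s, w) ∈ incidenceTangent S Sigma.fst (fun j => P j.1) (A, μ, v)) (e : E) :
      ∀ x ∈ eigenspaceOf A.1 (μ e), ∀ y ∈ eigenspaceOf A.1 (μ e),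
        x ⬝ᵥ H.1 *ᵥ y = s e * (x ⬝ᵥ y) := by
    intro x hx y hy
    have hxv (p : P e) : x ⬝ᵥ H.1 *ᵥ v ⟨e, p⟩ = s e * (x ⬝ᵥ v ⟨e, p⟩) := by
      have := congrArg (x ⬝ᵥ ·) ((mem_incidenceTangent.1 h).1 ⟨e, p⟩)
      simpa only [dotProduct_add, dotProduct_mulVec_of_mem_eigenspaceOf hA hx, dotProduct_smul,
        smul_eq_mul, add_right_inj] using this
    rw [(hP e).eq_sum (fun p => hv ⟨e, p⟩) (fun p => hdual ⟨e, p⟩) hy]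
    simp only [Matrix.mulVec_sum, Matrix.mulVec_smul, dotProduct_sum, dotProduct_smul, hxv,
      smul_eq_mul, Finset.mul_sum, mul_left_comm]
  refine LinearMap.finrank_le_finrank_of_injective (f := ((LinearMap.fst ℝ S _).restrict
    fun q hq => Submodule.mem_iInf _ |>.2 fun e => ⟨q.2.1 e, hscalar hq e⟩))
    ((injective_iff_map_eq_zero _).2 ?_)
  rintro ⟨⟨H, s, w⟩, hq⟩ hH
  obtain rfl : H = 0 := congrArg Subtype.val hH
  have hs : s = 0 := by
    funext e
    obtain ⟨x, hx, hx0⟩ := Submodule.exists_mem_ne_zero_of_ne_bot (hμ e)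
    have : s e * (x ⬝ᵥ x) = 0 := by simpa using (hscalar hq e x hx x hx).symm
    exact (mul_eq_zero.1 this).resolve_right (dotProduct_self_eq_zero.not.2 hx0)
  subst hs
  obtain ⟨hw, hwP⟩ := mem_incidenceTangent.1 hq
  have hw0 : w = 0 := funext fun j => (hP j.1).eq_zero
    (mem_eigenspaceOf.2 (by simpa using hw j)) (hwP j)
  subst hw0
  rfl

theorem dimH_setOf_finrank_iInf_scalarCompression_le [Finite E] (hS : ∀ A ∈ S, A.IsSymm)
    (m : ℕ) : dimH {A : S | ∃ μ : E → ℝ, (∀ e, eigenspaceOf A.1 (μ e) ≠ ⊥) ∧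
      finrank ℝ (⨅ e, scalarCompression S (eigenspaceOf A.1 (μ e)) : Submodule ℝ S) ≤ m} ≤ m := by
  have hsub : {A : S | ∃ μ : E → ℝ, (∀ e, eigenspaceOf A.1 (μ e) ≠ ⊥) ∧
      finrank ℝ (⨅ e, scalarCompression S (eigenspaceOf A.1 (μ e)) : Submodule ℝ S) ≤ m} ⊆
      ⋃ P : E → Finset ι, {A : S | ∃ (μ : E → ℝ) (v : (Σ e, P e) → ι → ℝ),
        (∀ j, A.1 *ᵥ v j = μ j.1 • v j) ∧
        (∀ j, ∀ l ∈ P j.1, v j l = (Pi.single (j.2 : ι) 1 : ι → ℝ) l) ∧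
        finrank ℝ (incidenceTangent S Sigma.fst (fun j => P j.1) (A, μ, v)) ≤ m} := by
    rintro A ⟨μ, hμ, hm⟩
    choose P hP using fun e => exists_isPivotSet (eigenspaceOf A.1 (μ e))
    choose v hv hdual using fun j : Σ e, P e => (hP j.1).exists_eq_on (Pi.single j.2 1)
    refine mem_iUnion.2 ⟨P, μ, v, fun j => mem_eigenspaceOf.1 (hv j), fun j l hl => ?_,
      (finrank_incidenceTangent_le_scalarCompression (hS A A.2) hμ hP hv hdual).trans hm⟩
    rw [hdual j ⟨l, hl⟩]
    simp [Pi.single_apply, Subtype.ext_iff]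
  refine (dimH_mono hsub).trans ?_
  rw [dimH_iUnion]
  exact iSup_le fun P => dimH_setOf_exists_incidence_le _ _ m

end Compression

section AnnihilatorIncidence

variable {ι E J : Type*} [Fintype ι]

/-- The matrices in `S` that annihilate every vector of the family `v`. -/
def annihilator (S : Submodule ℝ (Matrix ι ι ℝ)) (v : J → ι → ℝ) : Submodule ℝ S where
  carrier := {H | ∀ j, H.1 *ᵥ v j = 0}
  zero_mem' := by simp
  add_mem' hH hH' j := by simp [Matrix.add_mulVec, hH j, hH' j]
  smul_mem' c H hH j := by simp [Matrix.smul_mulVec, hH j]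

theorem finrank_incidenceTangent_le [DecidableEq ι] [Fintype E] [Fintype J]
    {S : Submodule ℝ (Matrix ι ι ℝ)} (π : J → E) (C : J → Finset ι) (A : S) (μ : E → ℝ)
    (v : J → ι → ℝ) :
    finrank ℝ (incidenceTangent S π C (A, μ, v)) ≤
      finrank ℝ (annihilator S v) + Fintype.card E + ∑ j, (C j)ᶜ.card := by
  set T := incidenceTangent S π C (A, μ, v)
  let f : T →ₗ[ℝ] (E → ℝ) × ((j : J) → ↥(C j)ᶜ → ℝ) := (LinearMap.id.prodMap
    (LinearMap.pi fun j => LinearMap.funLeft ℝ ℝ ((↑) : ↥(C j)ᶜ → ι) ∘ₗ LinearMap.proj j)) ∘ₗ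
    LinearMap.snd ℝ S ((E → ℝ) × (J → ι → ℝ)) ∘ₗ T.subtype
  have hker {p : T} (hp : f p = 0) : p.1.2 = 0 := by
    obtain ⟨⟨H, s, w⟩, h⟩ := p
    obtain ⟨hs, hw⟩ := Prod.mk_eq_zero.1 hp
    refine Prod.mk_eq_zero.2 ⟨hs, funext fun j => funext fun l => ?_⟩
    by_cases hl : l ∈ C j
    · exact (mem_incidenceTangent.1 h).2 j l hl
    · exact congrFun (congrFun hw j) ⟨l, Finset.mem_compl.2 hl⟩
  have hann (p : LinearMap.ker f) : p.1.1.1 ∈ annihilator S v := fun j => by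
    have h := (mem_incidenceTangent.1 p.1.2).1 j
    have h0 : p.1.1.2 = 0 := hker p.2
    simpa [h0] using h
  have hinj : finrank ℝ (LinearMap.ker f) ≤ finrank ℝ (annihilator S v) :=
    LinearMap.finrank_le_finrank_of_injective
      (f := (LinearMap.fst ℝ S _ ∘ₗ T.subtype ∘ₗ (LinearMap.ker f).subtype).codRestrict _ hann)
      fun p p' h => Subtype.ext (Subtype.ext (Prod.ext (congrArg Subtype.val h)
        ((hker p.2).trans (hker p'.2).symm)))
  have hrange := (LinearMap.range f).finrank_le
  rw [finrank_prod, finrank_fintype_fun_eq_card, finrank_pi_fintype] at hrange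
  simp only [finrank_fintype_fun_eq_card, Fintype.card_coe] at hrange
  have := LinearMap.finrank_range_add_finrank_ker (K := ℝ) (V := T) f
  omega

end AnnihilatorIncidence

section GraphPattern

variable {ι : Type*}

theorem exists_adj_notMem_mem {G : SimpleGraph ι} (hG : G.Connected) {X : Set ι} {i j : ι}
    (hi : i ∈ X) (hj : j ∉ X) : ∃ l ∉ X, ∃ m ∈ X, G.Adj l m := by
  obtain ⟨p⟩ := hG.preconnected i j
  obtain ⟨d, -, hd, hd'⟩ := p.exists_boundary_dart X hi hj
  exact ⟨d.snd, hd', d.fst, hd, d.adj.symm⟩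

/-- The real symmetric matrices whose nonzero off-diagonal entries sit at edges of the graph `G`.
Banded matrices are the case where `l` and `m` are adjacent if `0 < |l - m| ≤ k`. -/
def graphSymm (G : SimpleGraph ι) : Submodule ℝ (Matrix ι ι ℝ) where
  carrier := {A | A.IsSymm ∧ ∀ l m, l ≠ m → ¬ G.Adj l m → A l m = 0}
  zero_mem' := ⟨Matrix.isSymm_zero, fun _ _ _ _ => rfl⟩
  add_mem' := fun ⟨hA, hA'⟩ ⟨hB, hB'⟩ => ⟨hA.add hB, fun l m hlm h => by
    rw [Matrix.add_apply, hA' l m hlm h, hB' l m hlm h, add_zero]⟩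
  smul_mem' c _ := fun ⟨hA, hA'⟩ => ⟨hA.smul c, fun l m hlm h => by
    rw [Matrix.smul_apply, hA' l m hlm h, smul_zero]⟩

variable [DecidableEq ι]

/-- The symmetric matrix of the quadratic form `2 x_l x_m`: it has entries `1` at `(l, m)` and
`(m, l)` if `l ≠ m`, and the entry `2` at `(l, l)` if `l = m`. -/
def symUnit (l m : ι) : Matrix ι ι ℝ := Matrix.single l m 1 + Matrix.single m l 1

variable {G : SimpleGraph ι}

theorem diagonal_mem_graphSymm (d : ι → ℝ) : Matrix.diagonal d ∈ graphSymm G :=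
  ⟨Matrix.isSymm_diagonal d, fun _ _ hlm _ => Matrix.diagonal_apply_ne d hlm⟩

theorem symUnit_mem_graphSymm {l m : ι} (h : l = m ∨ G.Adj l m) :
    symUnit l m ∈ graphSymm G := by
  refine ⟨?_, fun i j hne hij => ?_⟩
  · simp [symUnit, Matrix.IsSymm, Matrix.transpose_add, Matrix.transpose_single, add_comm]
  · have h₁ : ¬(l = i ∧ m = j) := fun ⟨hl, hm⟩ => h.elim (fun e => hne (hl ▸ hm ▸ e))
      fun e => hij (hl ▸ hm ▸ e)
    have h₂ : ¬(m = i ∧ l = j) := fun ⟨hm, hl⟩ => h.elim (fun e => hne (hl ▸ hm ▸ e.symm))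
      fun e => hij (hl ▸ hm ▸ e.symm)
    simp [symUnit, h₁, h₂]

variable [Fintype ι]

theorem symUnit_mulVec (l m : ι) (x : ι → ℝ) :
    symUnit l m *ᵥ x = Pi.single l (x m) + Pi.single m (x l) := by
  rw [symUnit, Matrix.add_mulVec, Matrix.single_mulVec, Matrix.single_mulVec, one_mul, one_mul]
  rfl

theorem dotProduct_symUnit_mulVec (l m : ι) (x y : ι → ℝ) :
    x ⬝ᵥ symUnit l m *ᵥ y = x l * y m + x m * y l := by
  rw [symUnit_mulVec, dotProduct_add, dotProduct_single, dotProduct_single]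

end GraphPattern

section ExceptionalMatrices

variable {ι : Type*} [Fintype ι] {G : SimpleGraph ι}

theorem mul_eq_zero_of_forall_dotProduct_mulVec_eq_zero {x y : ι → ℝ}
    (h : ∀ H ∈ graphSymm G, x ⬝ᵥ H *ᵥ y = 0) (l m : ι) (hlm : l = m ∨ G.Adj l m) :
    x l * y m = 0 := by
  classical
  have hsymm := h _ (symUnit_mem_graphSymm hlm)
  have hdiag := h _ (symUnit_mem_graphSymm (.inl (Eq.refl l)))
  rw [dotProduct_symUnit_mulVec] at hsymm hdiag
  obtain hx | hy := mul_eq_zero.1 (by linarith : x l * y l = 0)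
  · rw [hx, zero_mul]
  · rwa [hy, mul_zero, add_zero] at hsymm

theorem separatesPairs_graphSymm_of_adj {i j : ι} (hij : G.Adj i j) {M : Submodule ℝ (ι → ℝ)}
    (hM : ∀ w ∈ M, w i = 0 → w j = 0 → w = 0) : SeparatesPairs (graphSymm G) M := by
  intro x hx y hy hx0 hy0
  by_contra! h
  have hmul := mul_eq_zero_of_forall_dotProduct_mulVec_eq_zero h
  by_cases hxi : x i = 0
  · have hxj : x j ≠ 0 := fun hxj => hx0 (hM x hx hxi hxj)
    exact hy0 (hM y hy ((mul_eq_zero.1 (hmul j i (.inr hij.symm))).resolve_left hxj)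
      ((mul_eq_zero.1 (hmul j j (.inl rfl))).resolve_left hxj))
  · exact hy0 (hM y hy ((mul_eq_zero.1 (hmul i i (.inl rfl))).resolve_left hxi)
      ((mul_eq_zero.1 (hmul i j (.inr hij))).resolve_left hxi))

theorem exists_normalized_pair_of_not_separatesPairs {M : Submodule ℝ (ι → ℝ)}
    (h : ¬ SeparatesPairs (graphSymm G) M) :
    ∃ (x : Fin 2 → ι → ℝ) (i : Fin 2 → ι), (∀ e, x e ∈ M) ∧ (∀ e, x e (i e) = 1) ∧
      ∀ l m, l = m ∨ G.Adj l m → x 0 l * x 1 m = 0 := by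
  simp only [SeparatesPairs] at h
  push Not at h
  obtain ⟨x, hx, y, hy, hx0, hy0, hxy⟩ := h
  obtain ⟨i, hi⟩ := Function.ne_iff.1 hx0
  obtain ⟨j, hj⟩ := Function.ne_iff.1 hy0
  refine ⟨![(x i)⁻¹ • x, (y j)⁻¹ • y], ![i, j], Fin.forall_fin_two.2
    ⟨M.smul_mem _ hx, M.smul_mem _ hy⟩, Fin.forall_fin_two.2
    ⟨inv_mul_cancel₀ hi, inv_mul_cancel₀ hj⟩, fun l m hlm => ?_⟩
  have := mul_eq_zero_of_forall_dotProduct_mulVec_eq_zero hxy l m hlm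
  change (x i)⁻¹ * x l * ((y j)⁻¹ * y m) = 0
  rw [mul_mul_mul_comm, this, mul_zero]

theorem eq_zero_of_diagonal_add_symUnit_mulVec_eq_zero [DecidableEq ι] {x : Fin 2 → ι → ℝ}
    (hdisj : ∀ l m, l = m ∨ G.Adj l m → x 0 l * x 1 m = 0) {l₀ m₀ l₁ m₁ : ι}
    (h₀ : G.Adj l₀ m₀) (hl₀ : x 0 l₀ = 0) (hm₀ : x 0 m₀ ≠ 0)
    (h₁ : G.Adj l₁ m₁) (hl₁ : x 1 l₁ = 0) (hm₁ : x 1 m₁ ≠ 0) {d : ι → ℝ} {α β : ℝ}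
    (h : ∀ e, (Matrix.diagonal d + (α • symUnit l₀ m₀ + β • symUnit l₁ m₁)) *ᵥ x e = 0) :
    α = 0 ∧ β = 0 ∧ ∀ e l, d l * x e l = 0 := by
  have hadj {l m} (h : G.Adj l m) := mul_eq_zero.1 (hdisj l m (.inr h))
  have hdiag l := mul_eq_zero.1 (hdisj l l (.inl rfl))
  have hrow e l : d l * x e l +
      (α * ((Pi.single l₀ (x e m₀) : ι → ℝ) l + (Pi.single m₀ (x e l₀) : ι → ℝ) l) +
      β * ((Pi.single l₁ (x e m₁) : ι → ℝ) l + (Pi.single m₁ (x e l₁) : ι → ℝ) l)) = 0 := by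
    simpa only [Matrix.add_mulVec, Matrix.smul_mulVec, symUnit_mulVec, Pi.add_apply,
      Pi.smul_apply, smul_eq_mul, Matrix.mulVec_diagonal, Pi.zero_apply] using congrFun (h e) l
  have hα : α = 0 := by
    have hl₁0 := (hadj h₁).resolve_right hm₁
    have hm₁0 := (hdiag m₁).resolve_right hm₁
    simpa [hl₀, hl₁0, hm₁0, hm₀] using hrow 0 l₀
  have hβ : β = 0 := by
    have hl₀0 := (hadj h₀.symm).resolve_left hm₀
    have hm₀0 := (hdiag m₀).resolve_left hm₀
    simpa [hl₁, hl₀0, hm₀0, hm₁] using hrow 1 l₁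
  exact ⟨hα, hβ, fun e l => by simpa [hα, hβ] using hrow e l⟩

/-- The vectors `x 0` and `x 1` have disjoint and non-adjacent supports. The diagonal matrices
supported there move them independently, and so do two more edges that connect a support to its
complement. -/
theorem finrank_annihilator_add_le (hG : G.Connected) {x : Fin 2 → ι → ℝ} (hx : ∀ e, x e ≠ 0)
    (hdisj : ∀ l m, l = m ∨ G.Adj l m → x 0 l * x 1 m = 0) :
    finrank ℝ (annihilator (graphSymm G) x) +
      (∑ e, (Finset.univ.filter (x e · ≠ 0)).card + 2) ≤ finrank ℝ (graphSymm G) := by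
  classical
  have hdiag l := mul_eq_zero.1 (hdisj l l (.inl rfl))
  obtain ⟨i, hi⟩ := Function.ne_iff.1 (hx 0)
  obtain ⟨j, hj⟩ := Function.ne_iff.1 (hx 1)
  obtain ⟨l₀, hl₀, m₀, hm₀, h₀⟩ := exists_adj_notMem_mem hG (X := {l | x 0 l ≠ 0}) hi
    (not_not.2 ((hdiag j).resolve_right hj))
  obtain ⟨l₁, hl₁, m₁, hm₁, h₁⟩ := exists_adj_notMem_mem hG (X := {l | x 1 l ≠ 0}) hj
    (not_not.2 ((hdiag i).resolve_left hi))
  set W := Finset.univ.filter fun l => x 0 l ≠ 0 ∨ x 1 l ≠ 0 with hW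
  have hWcard : W.card = ∑ e, (Finset.univ.filter (x e · ≠ 0)).card := by
    rw [hW, Finset.filter_or, Finset.card_union_of_disjoint, Fin.sum_univ_two]
    exact Finset.disjoint_filter.2 fun l _ h => not_not.2 ((hdiag l).resolve_left h)
  let D : (W → ℝ) →ₗ[ℝ] graphSymm G := (Matrix.diagonalLinearMap ι ℝ ℝ).codRestrict _
    diagonal_mem_graphSymm ∘ₗ Function.ExtendByZero.linearMap ℝ (Subtype.val : W → ι)
  let U {l m} (h : G.Adj l m) : ℝ →ₗ[ℝ] graphSymm G :=
    LinearMap.toSpanSingleton ℝ _ ⟨_, symUnit_mem_graphSymm (.inr h)⟩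
  rw [← hWcard]
  have := finrank_add_finrank_le_of_mem_imp_eq_zero (T := annihilator (graphSymm G) x)
    (D.coprod ((U h₀).coprod (U h₁))) ?_
  · simpa using this
  rintro ⟨c, α, β⟩ h
  obtain ⟨rfl, rfl, hd⟩ := eq_zero_of_diagonal_add_symUnit_mulVec_eq_zero hdisj h₀
    (not_not.1 hl₀) hm₀ h₁ (not_not.1 hl₁) hm₁ (d := Function.extend Subtype.val c 0) h
  refine Prod.mk_eq_zero.2 ⟨funext fun l => ?_, rfl⟩
  have hl e : c l * x e l = 0 := by simpa [Subtype.val_injective.extend_apply] using hd e l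
  obtain h | h := (Finset.mem_filter.1 l.2).2
  · exact (mul_eq_zero.1 (hl 0)).resolve_right h
  · exact (mul_eq_zero.1 (hl 1)).resolve_right h

variable [DecidableEq ι]

theorem finrank_incidenceTangent_support_add_le (hG : G.Connected) {x : Fin 2 → ι → ℝ}
    {i : Fin 2 → ι} (hi : ∀ e, x e (i e) ≠ 0)
    (hdisj : ∀ l m, l = m ∨ G.Adj l m → x 0 l * x 1 m = 0) (A : graphSymm G) (μ : Unit → ℝ) :
    finrank ℝ (incidenceTangent (graphSymm G) (fun _ => ())
      (fun e => insert (i e) (Finset.univ.filter (x e · ≠ 0))ᶜ) (A, μ, x)) + 3 ≤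
      finrank ℝ (graphSymm G) := by
  have hcard e : (insert (i e) (Finset.univ.filter (x e · ≠ 0))ᶜ)ᶜ.card + 1 =
      (Finset.univ.filter (x e · ≠ 0)).card := by
    rw [Finset.compl_insert, compl_compl, Finset.card_erase_add_one (by simpa using hi e)]
  have htangent := finrank_incidenceTangent_le (fun _ => ())
    (fun e => insert (i e) (Finset.univ.filter (x e · ≠ 0))ᶜ) A μ x
  have hann := finrank_annihilator_add_le hG (fun e h => hi e (congrFun h _)) hdisj
  simp only [Fintype.card_unit, Fin.sum_univ_two, ← hcard] at htangent hann
  omega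

/-- Stratify by the supports of two vectors of the eigenspace that no matrix of the pattern pairs,
normalized at one coordinate each. -/
theorem dimH_setOf_exists_not_separatesPairs_le (hG : G.Connected) :
    dimH {A : graphSymm G | ∃ μ, ¬ SeparatesPairs (graphSymm G) (eigenspaceOf A.1 μ)} ≤
      (finrank ℝ (graphSymm G) - 3 : ℕ) := by
  let S := graphSymm G
  let C (P : (Fin 2 → Finset ι) × (Fin 2 → ι)) (e : Fin 2) := insert (P.2 e) (P.1 e)ᶜ
  have hsub : {A : S | ∃ μ, ¬ SeparatesPairs S (eigenspaceOf A.1 μ)} ⊆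
      ⋃ P : (Fin 2 → Finset ι) × (Fin 2 → ι), {A : S | ∃ (μ : Unit → ℝ) (x : Fin 2 → ι → ℝ),
        (∀ e, A.1 *ᵥ x e = μ () • x e) ∧
        (∀ e, ∀ l ∈ C P e, x e l = (Pi.single (P.2 e) 1 : ι → ℝ) l) ∧
        finrank ℝ (incidenceTangent S (fun _ => ()) (C P) (A, μ, x)) ≤ finrank ℝ S - 3} := by
    rintro A ⟨μ, hμ⟩
    obtain ⟨x, i, hx, hi, hdisj⟩ := exists_normalized_pair_of_not_separatesPairs hμ
    refine mem_iUnion.2 ⟨(fun e => Finset.univ.filter (x e · ≠ 0), i), fun _ => μ, x,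
      fun e => mem_eigenspaceOf.1 (hx e), fun e l hl => ?_, Nat.le_sub_of_add_le
      (finrank_incidenceTangent_support_add_le hG (fun e => by simp [hi e]) hdisj A _)⟩
    obtain rfl | hl := Finset.mem_insert.1 hl
    · rw [hi, Pi.single_eq_same]
    · have hl0 : x e l = 0 := by simpa using hl
      rw [hl0, Pi.single_eq_of_ne]
      rintro rfl
      simp [hi] at hl0
  refine (dimH_mono hsub).trans ?_
  rw [dimH_iUnion]
  exact iSup_le fun P => dimH_setOf_exists_incidence_le _ _ _

end ExceptionalMatrices

section TwoDoubleEigenvalues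

variable {ι : Type*} {M N : Submodule ℝ (ι → ℝ)} {o : ι}

theorem exists_mem_ne_zero_apply_eq_zero [Finite ι] (hM : 2 ≤ finrank ℝ M) (o : ι) :
    ∃ x ∈ M, x ≠ 0 ∧ x o = 0 := by
  have hker : LinearMap.ker (LinearMap.proj (R := ℝ) (φ := fun _ : ι => ℝ) o ∘ₗ M.subtype) ≠ ⊥ :=
    LinearMap.ker_ne_bot_of_finrank_lt (by rw [finrank_self]; omega)
  obtain ⟨x, hx, hx0⟩ := Submodule.exists_mem_ne_zero_of_ne_bot hker
  exact ⟨x, x.2, fun h => hx0 (Subtype.ext h), hx⟩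

variable [Fintype ι]

/-- `x, y` is an orthogonal basis of the plane `M` with `x o = 0` and `y o = 1`. -/
structure IsAdaptedBasis (M : Submodule ℝ (ι → ℝ)) (o : ι) (x y : ι → ℝ) : Prop where
  span_eq : Submodule.span ℝ {x, y} = M
  left_ne_zero : x ≠ 0
  left_apply : x o = 0
  right_apply : y o = 1
  dotProduct_eq : x ⬝ᵥ y = 0

theorem exists_isAdaptedBasis (hM : finrank ℝ M = 2) (ho : ∃ w ∈ M, w o ≠ 0) :
    ∃ x y, IsAdaptedBasis M o x y := by
  obtain ⟨x, hx, hx0, hxo⟩ := exists_mem_ne_zero_apply_eq_zero hM.ge o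
  obtain ⟨w, hw, hwo⟩ := ho
  have hxx : x ⬝ᵥ x ≠ 0 := dotProduct_self_eq_zero.not.2 hx0
  let y := (w o)⁻¹ • (w - ((x ⬝ᵥ w) / (x ⬝ᵥ x)) • x)
  have hyo : y o = 1 := by simp [y, hxo, hwo]
  have hy : y ∈ M := M.smul_mem _ (M.sub_mem hw (M.smul_mem _ hx))
  have hli : LinearIndependent ℝ ![x, y] := by
    refine LinearIndependent.pair_iff.2 fun s t h => ?_
    have ht : t = 0 := by simpa [hxo, hyo] using congrFun h o
    subst ht
    exact ⟨(smul_eq_zero.1 (by simpa using h)).resolve_right hx0, rfl⟩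
  refine ⟨x, y, Submodule.eq_of_le_of_finrank_eq (Submodule.span_le.2 ?_) ?_, hx0, hxo, hyo, ?_⟩
  · exact insert_subset hx (singleton_subset_iff.2 hy)
  · rw [hM, ← Matrix.range_cons_cons_empty, finrank_span_eq_card hli, Fintype.card_fin]
  · simp [y, dotProduct_smul, dotProduct_sub, div_mul_cancel₀ _ hxx]

variable {x y : ι → ℝ}

namespace IsAdaptedBasis

theorem mem_left (h : IsAdaptedBasis M o x y) : x ∈ M :=
  h.span_eq ▸ Submodule.subset_span (.inl rfl)

theorem mem_right (h : IsAdaptedBasis M o x y) : y ∈ M :=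
  h.span_eq ▸ Submodule.subset_span (.inr rfl)

theorem mem_scalarCompression {S : Submodule ℝ (Matrix ι ι ℝ)} (h : IsAdaptedBasis M o x y) {H : S}
    (hH : H.1.IsSymm) (hxy : x ⬝ᵥ H.1 *ᵥ y = 0)
    (hyy : (y ⬝ᵥ y) * (x ⬝ᵥ H.1 *ᵥ x) = (x ⬝ᵥ x) * (y ⬝ᵥ H.1 *ᵥ y)) :
    H ∈ scalarCompression S M := by
  have hxx : x ⬝ᵥ x ≠ 0 := dotProduct_self_eq_zero.not.2 h.left_ne_zero
  have hyx : y ⬝ᵥ H.1 *ᵥ x = 0 := by rw [dotProduct_mulVec_comm_of_isSymm hH, hxy]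
  refine ⟨(x ⬝ᵥ H.1 *ᵥ x) / (x ⬝ᵥ x), fun w hw z hz => ?_⟩
  rw [← h.span_eq] at hw hz
  obtain ⟨a, b, rfl⟩ := Submodule.mem_span_pair.1 hw
  obtain ⟨c, d, rfl⟩ := Submodule.mem_span_pair.1 hz
  rw [div_mul_eq_mul_div, eq_div_iff hxx]
  simp only [Matrix.mulVec_add, Matrix.mulVec_smul, dotProduct_add, add_dotProduct, dotProduct_smul,
    smul_dotProduct, smul_eq_mul, hxy, hyx, h.dotProduct_eq, dotProduct_comm y x]
  linear_combination (-(b * d)) * hyy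

end IsAdaptedBasis

variable [DecidableEq ι] {G : SimpleGraph ι} {u v : ι → ℝ}

/-- An element of `graphSymm G` supported on the entries of `{o, l}`. -/
def starMatrix (a b c : ℝ) {o l : ι} (h : o = l ∨ G.Adj o l) : graphSymm G :=
  a • ⟨symUnit l l, symUnit_mem_graphSymm (.inl rfl)⟩ + b • ⟨symUnit o l, symUnit_mem_graphSymm h⟩ +
    c • ⟨symUnit o o, symUnit_mem_graphSymm (.inl rfl)⟩

theorem dotProduct_starMatrix_mulVec (a b c : ℝ) {l : ι} (h : o = l ∨ G.Adj o l) (x y : ι → ℝ) :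
    x ⬝ᵥ (starMatrix a b c h).1 *ᵥ y =
      2 * a * (x l * y l) + b * (x o * y l + x l * y o) + 2 * c * (x o * y o) := by
  simp only [starMatrix, Submodule.coe_add, Submodule.coe_smul, Matrix.add_mulVec,
    Matrix.smul_mulVec, dotProduct_add, dotProduct_smul, dotProduct_symUnit_mulVec, smul_eq_mul]
  ring

theorem symUnit_mem_scalarCompression_iff {S : Submodule ℝ (Matrix ι ι ℝ)}
    (hS : symUnit o o ∈ S) (hM : 2 ≤ finrank ℝ M) :
    ⟨symUnit o o, hS⟩ ∈ scalarCompression S M ↔ ∀ w ∈ M, w o = 0 := by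
  constructor
  · rintro ⟨s, hs⟩ w hw
    simp only [dotProduct_symUnit_mulVec] at hs
    obtain ⟨x, hx, hx0, hxo⟩ := exists_mem_ne_zero_apply_eq_zero hM o
    have hs0 : s = 0 := by
      have : s * (x ⬝ᵥ x) = 0 := by simpa [hxo] using (hs x hx x hx).symm
      exact (mul_eq_zero.1 this).resolve_right (dotProduct_self_eq_zero.not.2 hx0)
    have hww := hs w hw w hw
    rw [hs0, zero_mul] at hww
    exact mul_self_eq_zero.1 (by linarith)
  · exact fun h => ⟨0, fun x hx y hy => by simp [dotProduct_symUnit_mulVec, h x hx, h y hy]⟩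

namespace IsAdaptedBasis

theorem starMatrix_mem (h : IsAdaptedBasis M o x y) {l : ι} (hl : o = l ∨ G.Adj o l) {a b : ℝ}
    (hab : (2 * a * y l + b) * x l = 0) :
    ∃ c, starMatrix a b c hl ∈ scalarCompression (graphSymm G) M := by
  have hxx : x ⬝ᵥ x ≠ 0 := dotProduct_self_eq_zero.not.2 h.left_ne_zero
  refine ⟨((y ⬝ᵥ y) * a * (x l * x l) / (x ⬝ᵥ x)) - a * (y l * y l) - b * y l,
    h.mem_scalarCompression (starMatrix _ _ _ hl).2.1 ?_ ?_⟩
  · rw [dotProduct_starMatrix_mulVec, h.left_apply, h.right_apply]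
    linear_combination hab
  · simp only [dotProduct_starMatrix_mulVec, h.left_apply, h.right_apply]
    field_simp
    ring

theorem left_apply_eq_zero_of_starMatrix_mem (h : IsAdaptedBasis M o x y) {l : ι}
    {hl : o = l ∨ G.Adj o l} {a b c : ℝ}
    (hH : starMatrix a b c hl ∈ scalarCompression (graphSymm G) M) (hb : 2 * a * y l + b ≠ 0) :
    x l = 0 := by
  obtain ⟨s, hs⟩ := hH
  have hxy := hs x h.mem_left y h.mem_right
  rw [dotProduct_starMatrix_mulVec, h.left_apply, h.right_apply, h.dotProduct_eq] at hxy
  exact (mul_eq_zero.1 (by linear_combination hxy : (2 * a * y l + b) * x l = 0)).resolve_left hb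

theorem right_apply_eq_neg_of_starMatrix_mem (h : IsAdaptedBasis M o x y) {l : ι}
    {hl : o = l ∨ G.Adj o l} {c : ℝ}
    (hH : starMatrix 0 1 c hl ∈ scalarCompression (graphSymm G) M) : y l = -c := by
  obtain ⟨s, hs⟩ := hH
  have hxx := hs x h.mem_left x h.mem_left
  have hyy := hs y h.mem_right y h.mem_right
  rw [dotProduct_starMatrix_mulVec, h.left_apply] at hxx
  have hs0 : s = 0 := by
    have : s * (x ⬝ᵥ x) = 0 := by linear_combination -hxx
    exact (mul_eq_zero.1 this).resolve_right (dotProduct_self_eq_zero.not.2 h.left_ne_zero)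
  rw [dotProduct_starMatrix_mulVec, h.right_apply, hs0] at hyy
  linear_combination hyy / 2

omit [DecidableEq ι] in
theorem right_apply_eq_of_left_apply_eq_zero (h : IsAdaptedBasis M o x y)
    (h' : IsAdaptedBasis N o u v)
    (hMN : scalarCompression (graphSymm G) M ≤ scalarCompression (graphSymm G) N) {l : ι}
    (hl : o = l ∨ G.Adj o l) (hx : x l = 0) : y l = v l := by
  classical
  obtain ⟨c, hc⟩ := h.starMatrix_mem hl (a := 0) (b := 1) (by rw [hx, mul_zero])
  rw [h.right_apply_eq_neg_of_starMatrix_mem hc,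
    h'.right_apply_eq_neg_of_starMatrix_mem (hMN hc)]

omit [DecidableEq ι] in
theorem right_apply_eq (h : IsAdaptedBasis M o x y) (h' : IsAdaptedBasis N o u v)
    (hMN : scalarCompression (graphSymm G) M = scalarCompression (graphSymm G) N) {l : ι}
    (hl : o = l ∨ G.Adj o l) : y l = v l := by
  classical
  by_cases hu : u l = 0
  · exact (h'.right_apply_eq_of_left_apply_eq_zero h hMN.ge hl hu).symm
  obtain ⟨c, hc⟩ := h.starMatrix_mem hl (a := 1) (b := -(2 * y l)) (by ring)
  by_contra hne
  exact hu (h'.left_apply_eq_zero_of_starMatrix_mem (hMN ▸ hc) fun h0 => hne (by linarith))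

end IsAdaptedBasis

/-- Testing with matrices supported on `{o, l}` recovers `y l`, for `l` adjacent to `o`, from the
space of scalar compressions to the plane. The row `o` of `A y = μ y` then determines `μ`. -/
theorem eq_of_scalarCompression_eq {A : graphSymm G} {μ ν : ℝ}
    (hμ : finrank ℝ (eigenspaceOf A.1 μ) = 2) (hν : finrank ℝ (eigenspaceOf A.1 ν) = 2)
    (h : scalarCompression (graphSymm G) (eigenspaceOf A.1 μ) =
      scalarCompression (graphSymm G) (eigenspaceOf A.1 ν)) : μ = ν := by
  obtain ⟨w, hw, hw0⟩ := Submodule.exists_mem_ne_zero_of_ne_bot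
    (Submodule.one_le_finrank_iff.1 (hμ.symm ▸ one_le_two))
  obtain ⟨o, ho⟩ := Function.ne_iff.1 hw0
  have hoo := symUnit_mem_graphSymm (G := G) (.inl (Eq.refl o))
  have hoν : ∃ w ∈ eigenspaceOf A.1 ν, w o ≠ 0 := by
    by_contra! hno
    exact ho ((symUnit_mem_scalarCompression_iff hoo hμ.ge).1
      (h ▸ (symUnit_mem_scalarCompression_iff hoo hν.ge).2 hno) w hw)
  obtain ⟨x, y, hxy⟩ := exists_isAdaptedBasis hμ ⟨w, hw, ho⟩
  obtain ⟨u, v, huv⟩ := exists_isAdaptedBasis hν hoν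
  have hA : (A.1 *ᵥ y) o = (A.1 *ᵥ v) o := Finset.sum_congr rfl fun l _ => by
    by_cases hl : o = l ∨ G.Adj o l
    · rw [hxy.right_apply_eq huv h hl]
    · push Not at hl
      change A.1 o l * y l = A.1 o l * v l
      rw [A.2.2 o l hl.1 hl.2, zero_mul, zero_mul]
  simpa [mem_eigenspaceOf.1 hxy.mem_right, mem_eigenspaceOf.1 huv.mem_right, hxy.right_apply,
    huv.right_apply] using hA

end TwoDoubleEigenvalues

section HigherMultiplicity

variable {ι : Type*} [Fintype ι] [DecidableEq ι]

theorem dimH_setOf_three_le_finrank_eigenspaceOf_le {S : Submodule ℝ (Matrix ι ι ℝ)}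
    (hS : ∀ A ∈ S, A.IsSymm) (hdiag : ∀ d, Matrix.diagonal d ∈ S) :
    dimH {A : S | ∃ μ, SeparatesPairs S (eigenspaceOf A.1 μ) ∧
      3 ≤ finrank ℝ (eigenspaceOf A.1 μ)} ≤ (finrank ℝ S - 3 : ℕ) := by
  refine (dimH_mono ?_).trans
    (dimH_setOf_finrank_iInf_scalarCompression_le (E := Unit) hS (finrank ℝ S - 3))
  rintro A ⟨μ, hsep, hμ⟩
  have := finrank_scalarCompression_add_le hdiag (by omega) hsep
  refine ⟨fun _ => μ, fun _ => Submodule.one_le_finrank_iff.1 (le_trans (by norm_num) hμ), ?_⟩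
  rw [iInf_const]
  omega

theorem dimH_setOf_two_double_eigenvalues_le {G : SimpleGraph ι} :
    dimH {A : graphSymm G | ∃ μ ν, μ ≠ ν ∧
      (SeparatesPairs (graphSymm G) (eigenspaceOf A.1 μ) ∧ finrank ℝ (eigenspaceOf A.1 μ) = 2) ∧
      SeparatesPairs (graphSymm G) (eigenspaceOf A.1 ν) ∧ finrank ℝ (eigenspaceOf A.1 ν) = 2} ≤
      (finrank ℝ (graphSymm G) - 3 : ℕ) := by
  refine (dimH_mono ?_).trans (dimH_setOf_finrank_iInf_scalarCompression_le (E := Fin 2)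
    (S := graphSymm G) (fun A hA => And.left hA) (finrank ℝ (graphSymm G) - 3))
  rintro A ⟨μ, ν, hne, ⟨hsepμ, hμ⟩, hsepν, hν⟩
  have hTμ := finrank_scalarCompression_add_le diagonal_mem_graphSymm hμ.ge hsepμ
  have hTν := finrank_scalarCompression_add_le diagonal_mem_graphSymm hν.ge hsepν
  refine ⟨![μ, ν], Fin.forall_fin_two.2 ⟨Submodule.one_le_finrank_iff.1 (hμ.symm ▸ one_le_two),
    Submodule.one_le_finrank_iff.1 (hν.symm ▸ one_le_two)⟩, ?_⟩
  refine (Submodule.finrank_mono (le_inf (iInf_le _ 0) (iInf_le _ 1))).trans ?_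
  change finrank ℝ ↥(scalarCompression (graphSymm G) (eigenspaceOf A.1 μ) ⊓
    scalarCompression (graphSymm G) (eigenspaceOf A.1 ν)) ≤ _
  by_contra! hlt
  exact hne (eq_of_scalarCompression_eq hμ hν
    ((Submodule.eq_of_le_of_finrank_le inf_le_left (by omega)).symm.trans
      (Submodule.eq_of_le_of_finrank_le inf_le_right (by omega))))

end HigherMultiplicity

section Elimination

variable {X E Y : Type*} [NormedAddCommGroup X] [NormedSpace ℝ X] [FiniteDimensional ℝ X]
  [NormedAddCommGroup E] [NormedSpace ℝ E] [CompleteSpace E]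
  [NormedAddCommGroup Y] [NormedSpace ℝ Y]

theorem exists_implicitFunction_fderiv_eq_zero {g : X × E → E} {z₀ : X × E}
    (hg : ContDiffAt ℝ ω g z₀) (hg₀ : g z₀ = 0)
    (hinv : (fderiv ℝ g z₀ ∘L .inr ℝ X E).IsInvertible) :
    ∃ ψ : X → E, ContDiffAt ℝ ω ψ z₀.1 ∧ ψ z₀.1 = z₀.2 ∧
      (∀ᶠ z in 𝓝 z₀, g z = 0 ↔ ψ z.1 = z.2) ∧
      ∀ H, fderiv ℝ g z₀ (H, 0) = 0 → fderiv ℝ ψ z₀.1 H = 0 := by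
  have hω : ω ≠ 0 := by simp
  refine ⟨hg.implicitFunction hω hinv, hg.contDiffAt_implicitFunction hω hinv,
    hg.implicitFunction_apply_self hω hinv, ?_, fun H hH => ?_⟩
  · simpa only [hg₀] using hg.eventually_apply_eq_iff_implicitFunction hω hinv
  · have hψ := (hg.hasStrictFDerivAt_implicitFunction hω hinv).hasFDerivAt.fderiv
    rw [hψ]
    simp [hH]

theorem isSubmanifoldAt_setOf_exists_of_eliminate [FiniteDimensional ℝ Y]
    {g : X × E → E} {h : X × E → Y} {z₀ : X × E} {Z : Set (X × E)} {d : ℕ}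
    (hg : ContDiffAt ℝ ω g z₀) (hh : ContDiffAt ℝ ω h z₀) (hz₀ : z₀ ∈ Z)
    (hZ : ∀ᶠ z in 𝓝 z₀, z ∈ Z ↔ g z = 0 ∧ h z = 0)
    (hproper : ∀ V ∈ 𝓝 z₀, ∀ᶠ x in 𝓝 z₀.1, ∀ s, (x, s) ∈ Z → (x, s) ∈ V)
    (hinv : (fderiv ℝ g z₀ ∘L .inr ℝ X E).IsInvertible)
    (hsurj : ∀ y, ∃ H, fderiv ℝ g z₀ (H, 0) = 0 ∧ fderiv ℝ h z₀ (H, 0) = y)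
    (hd : finrank ℝ X = d + finrank ℝ Y) :
    IsSubmanifoldAt d {x | ∃ s, (x, s) ∈ Z} z₀.1 := by
  obtain ⟨ψ, hψ, hψ₀, hψg, hψ'⟩ :=
    exists_implicitFunction_fderiv_eq_zero hg (hZ.self_of_nhds.1 hz₀).1 hinv
  let Γ : X → X × E := fun x => (x, ψ x)
  have hΓ₀ : Γ z₀.1 = z₀ := Prod.ext rfl hψ₀
  have hΓ : ContDiffAt ℝ ω Γ z₀.1 := contDiffAt_id.prodMk hψ
  have hΓt : Filter.Tendsto Γ (𝓝 z₀.1) (𝓝 z₀) := by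
    simpa only [ContinuousAt, hΓ₀] using hΓ.continuousAt
  have hhΓ : ContDiffAt ℝ ω (h ∘ Γ) z₀.1 := ContDiffAt.comp _ (hΓ₀ ▸ hh) hΓ
  have hhΓ' (H : X) : fderiv ℝ (h ∘ Γ) z₀.1 H = fderiv ℝ h z₀ (H, fderiv ℝ ψ z₀.1 H) := by
    have hh' : HasFDerivAt h (fderiv ℝ h z₀) (Γ z₀.1) :=
      hΓ₀ ▸ (hh.differentiableAt (by simp)).hasFDerivAt
    rw [(hh'.comp _ ((hasFDerivAt_id _).prodMk
      (hψ.differentiableAt (by simp)).hasFDerivAt)).fderiv]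
    rfl
  refine (isSubmanifoldAt_zeroSet_of_surjective_fderiv hhΓ (fun y => ?_) hd).congr ?_
  · obtain ⟨H, hgH, hhH⟩ := hsurj y
    exact ⟨H, by rw [hhΓ', hψ' H hgH, hhH]⟩
  · filter_upwards [hΓt.eventually (hZ.and hψg), hproper _ (hZ.and hψg)] with x hxΓ hxZ
    refine ⟨fun ⟨s, hs⟩ => ?_, fun hx => ⟨ψ x, hxΓ.1.2 ⟨hxΓ.2.2 rfl, hx⟩⟩⟩
    obtain ⟨hiff, hψs⟩ := hxZ s hs
    obtain ⟨hgs, hhs⟩ := hiff.1 hs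
    have hs' : ψ x = s := hψs.1 hgs
    change h (x, ψ x) = 0
    rw [hs', hhs]

end Elimination

section Frame

variable {ι : Type*} [Fintype ι] {S : Submodule ℝ (Matrix ι ι ℝ)}

variable (S) in
/-- The bilinear map `((A, μ), w) ↦ A w - μ w`. -/
noncomputable def shiftMulVec : (S × ℝ) →L[ℝ] (ι → ℝ) →L[ℝ] ι → ℝ :=
  (LinearMap.mk₂ ℝ (fun (z : S × ℝ) (w : ι → ℝ) => z.1.1 *ᵥ w - z.2 • w)
    (fun z z' w => by simp only [Prod.fst_add, Prod.snd_add, Submodule.coe_add, Matrix.add_mulVec,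
      add_smul, add_sub_add_comm])
    (fun c z w => by simp [Matrix.smul_mulVec, mul_smul, smul_sub])
    (fun z w w' => by simp only [Matrix.mulVec_add, smul_add, add_sub_add_comm])
    (fun c z w => by
      simp [Matrix.mulVec_smul, smul_sub, smul_comm c])).toContinuousBilinearMap

theorem shiftMulVec_apply (z : S × ℝ) (w : ι → ℝ) : shiftMulVec S z w = z.1.1 *ᵥ w - z.2 • w :=
  rfl

theorem dotProduct_shiftMulVec_comm (hS : ∀ A ∈ S, A.IsSymm) (z : S × ℝ) (x y : ι → ℝ) :
    x ⬝ᵥ shiftMulVec S z y = y ⬝ᵥ shiftMulVec S z x := by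
  rw [shiftMulVec_apply, shiftMulVec_apply, dotProduct_sub, dotProduct_sub,
    dotProduct_mulVec_comm_of_isSymm (hS _ z.1.2), dotProduct_smul, dotProduct_smul,
    dotProduct_comm x y]

variable [DecidableEq ι]

theorem mem_eigenspaceOf_iff_shiftMulVec_eq_zero {z : S × ℝ} {w : ι → ℝ} :
    w ∈ eigenspaceOf z.1.1 z.2 ↔ shiftMulVec S z w = 0 := by
  rw [mem_eigenspaceOf, shiftMulVec_apply, sub_eq_zero]

theorem dotProduct_shiftMulVec_of_mem_eigenspaceOf (hS : ∀ A ∈ S, A.IsSymm) {z : S × ℝ}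
    {x : ι → ℝ} (hx : x ∈ eigenspaceOf z.1.1 z.2) (y : ι → ℝ) :
    x ⬝ᵥ shiftMulVec S z y = 0 := by
  rw [dotProduct_shiftMulVec_comm hS, mem_eigenspaceOf_iff_shiftMulVec_eq_zero.1 hx,
    dotProduct_zero]

/-- The projection of `ι → ℝ` that forgets the coordinates in `P`. -/
def forgetCoords (P : Finset ι) : (ι → ℝ) →L[ℝ] ι → ℝ :=
  ContinuousLinearMap.pi fun l => if l ∈ P then 0 else ContinuousLinearMap.proj l

/-- The operator that replaces the rows in `P` of `A - μ` by the coordinates in `P`. Its inverse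
continues an eigenspace with pivots in `P` to neighbouring `(A, μ)`. -/
noncomputable def pivotSystem (P : Finset ι) (z : S × ℝ) : (ι → ℝ) →L[ℝ] ι → ℝ :=
  forgetCoords P ∘L shiftMulVec S z + (ContinuousLinearMap.id ℝ (ι → ℝ) - forgetCoords P)

theorem pivotSystem_apply (P : Finset ι) (z : S × ℝ) (w : ι → ℝ) (l : ι) :
    pivotSystem P z w l = if l ∈ P then w l else shiftMulVec S z w l := by
  change forgetCoords P (shiftMulVec S z w) l + (w l - forgetCoords P w l) = _
  by_cases hl : l ∈ P <;> simp [forgetCoords, hl]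

theorem contDiff_pivotSystem (P : Finset ι) : ContDiff ℝ ω (pivotSystem (S := S) P) :=
  (contDiff_const.clm_comp (shiftMulVec S).contDiff).add contDiff_const

theorem dotProduct_eq_apply_of_eq_single_on {P : Finset ι} {p : P} {v w : ι → ℝ}
    (hv : ∀ q : P, v q = (Pi.single p 1 : P → ℝ) q) (hw : ∀ l ∉ P, w l = 0) :
    v ⬝ᵥ w = w p := by
  refine (Finset.sum_eq_single (p : ι) (fun l _ hl => ?_) (by simp)).trans (by simp [hv p])
  by_cases hlP : l ∈ P
  · rw [hv ⟨l, hlP⟩, Pi.single_eq_of_ne (fun h => hl (congrArg Subtype.val h)), zero_mul]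
  · rw [hw l hlP, mul_zero]

theorem pivotSystem_injective {P : Finset ι} {z : S × ℝ} (hS : ∀ A ∈ S, A.IsSymm)
    (hP : IsPivotSet P (eigenspaceOf z.1.1 z.2)) : Function.Injective (pivotSystem P z) := by
  refine (injective_iff_map_eq_zero _).2 fun w hw => ?_
  have hwl (l : ι) : (if l ∈ P then w l else shiftMulVec S z w l) = 0 := by
    rw [← pivotSystem_apply, hw, Pi.zero_apply]
  have hrow (l : ι) (hl : l ∉ P) : shiftMulVec S z w l = 0 := by simpa [hl] using hwl l
  have hpivotRow (p : P) : shiftMulVec S z w p = 0 := by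
    obtain ⟨v, hv, hvp⟩ := hP.exists_eq_on (Pi.single p 1)
    rw [← dotProduct_shiftMulVec_of_mem_eigenspaceOf hS hv w]
    exact (dotProduct_eq_apply_of_eq_single_on hvp hrow).symm
  refine hP.eq_zero (mem_eigenspaceOf_iff_shiftMulVec_eq_zero.2 (funext fun l => ?_))
    fun p hp => by simpa [hp] using hwl p
  exact if hl : l ∈ P then hpivotRow ⟨l, hl⟩ else hrow l hl

/-- `u` is the frame obtained by solving the pivot system at `z` for the unit vectors in `P`. -/
structure IsPivotFrame (P : Finset ι) (z : S × ℝ) (u : P → ι → ℝ) : Prop where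
  injective : Function.Injective (pivotSystem P z)
  pivotSystem_eq (p : P) : pivotSystem P z (u p) = Pi.single (p : ι) 1

theorem exists_isPivotFrame {P : Finset ι} {z₀ : S × ℝ} (hS : ∀ A ∈ S, A.IsSymm)
    (hP : IsPivotSet P (eigenspaceOf z₀.1.1 z₀.2)) :
    ∃ U : P → S × ℝ → ι → ℝ, (∀ p, ContDiffAt ℝ ω (U p) z₀) ∧
      ∀ᶠ z in 𝓝 z₀, IsPivotFrame P z fun p => U p z := by
  let e : (ι → ℝ) ≃L[ℝ] (ι → ℝ) := (LinearEquiv.ofInjectiveEndo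
    (pivotSystem P z₀ : (ι → ℝ) →ₗ[ℝ] ι → ℝ) (pivotSystem_injective hS hP)).toContinuousLinearEquiv
  have he : (e : (ι → ℝ) →L[ℝ] (ι → ℝ)) = pivotSystem P z₀ := rfl
  have hinv : ContDiffAt ℝ ω (fun z : S × ℝ => (pivotSystem P z).inverse) z₀ :=
    ContDiffAt.comp (g := ContinuousLinearMap.inverse) z₀ (he ▸ contDiffAt_map_inverse e)
      (contDiff_pivotSystem P).contDiffAt
  refine ⟨fun p z => (pivotSystem P z).inverse (Pi.single (p : ι) 1),
    fun p => hinv.clm_apply contDiffAt_const, ?_⟩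
  filter_upwards [(contDiff_pivotSystem P).continuous.continuousAt.eventually
    (he ▸ ContinuousLinearEquiv.nhds e)]
  rintro z ⟨e', he'⟩
  refine ⟨he' ▸ e'.injective, fun p => ?_⟩
  rw [← he', ContinuousLinearMap.inverse_equiv]
  exact e'.apply_symm_apply _

namespace IsPivotFrame

variable {P : Finset ι} {z : S × ℝ} {u : P → ι → ℝ}

theorem apply_pivot (h : IsPivotFrame P z u) (p q : P) : u p q = (Pi.single p 1 : P → ℝ) q := by
  have hpq := congrFun (h.pivotSystem_eq p) q
  rw [pivotSystem_apply, if_pos q.2] at hpq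
  rw [hpq, Pi.single_apply, Pi.single_apply]
  simp only [Subtype.ext_iff]

theorem shiftMulVec_apply_eq_zero (h : IsPivotFrame P z u) (p : P) {l : ι} (hl : l ∉ P) :
    shiftMulVec S z (u p) l = 0 := by
  have hpl := congrFun (h.pivotSystem_eq p) l
  have hlp : l ≠ p := fun hlp => hl (hlp ▸ p.2)
  rwa [pivotSystem_apply, if_neg hl, Pi.single_eq_of_ne hlp] at hpl

theorem dotProduct_shiftMulVec (h : IsPivotFrame P z u) (p q : P) :
    u p ⬝ᵥ shiftMulVec S z (u q) = shiftMulVec S z (u q) p :=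
  dotProduct_eq_apply_of_eq_single_on (h.apply_pivot p) fun _ => h.shiftMulVec_apply_eq_zero q

theorem eq_of_mem_eigenspaceOf (h : IsPivotFrame P z u) {w : ι → ℝ}
    (hw : w ∈ eigenspaceOf z.1.1 z.2) {p : P} (hwp : ∀ q : P, w q = (Pi.single p 1 : P → ℝ) q) :
    w = u p := by
  refine h.injective (funext fun l => ?_)
  rw [pivotSystem_apply, pivotSystem_apply]
  split_ifs with hl
  · rw [hwp ⟨l, hl⟩, h.apply_pivot p ⟨l, hl⟩]
  · rw [mem_eigenspaceOf_iff_shiftMulVec_eq_zero.1 hw, h.shiftMulVec_apply_eq_zero p hl,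
      Pi.zero_apply]

theorem mem_eigenspaceOf_iff (h : IsPivotFrame P z u) {q : P} :
    u q ∈ eigenspaceOf z.1.1 z.2 ↔ ∀ p : P, u p ⬝ᵥ shiftMulVec S z (u q) = 0 := by
  rw [mem_eigenspaceOf_iff_shiftMulVec_eq_zero]
  refine ⟨fun hq p => by rw [hq, dotProduct_zero], fun hq => funext fun l => ?_⟩
  by_cases hl : l ∈ P
  · rw [← h.dotProduct_shiftMulVec ⟨l, hl⟩, hq, Pi.zero_apply]
  · exact h.shiftMulVec_apply_eq_zero q hl

theorem card_le_finrank_eigenspaceOf_iff (h : IsPivotFrame P z u) :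
    P.card ≤ finrank ℝ (eigenspaceOf z.1.1 z.2) ↔
      ∀ p q : P, u p ⬝ᵥ shiftMulVec S z (u q) = 0 := by
  let r := LinearMap.funLeft ℝ ℝ ((↑) : P → ι) ∘ₗ (eigenspaceOf z.1.1 z.2).subtype
  have hr : Function.Injective r := (injective_iff_map_eq_zero r).2 fun w hw =>
    Subtype.ext (h.injective (funext fun l => by
      have hwP (hl : l ∈ P) : w.1 l = 0 := congrFun hw ⟨l, hl⟩
      have hwz := mem_eigenspaceOf_iff_shiftMulVec_eq_zero.1 w.2
      simp +contextual [pivotSystem_apply, hwz, hwP]))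
  constructor
  · intro hcard p q
    have hpivot : IsPivotSet P (eigenspaceOf z.1.1 z.2) := by
      refine ⟨hr, (LinearMap.injective_iff_surjective_of_finrank_eq_finrank
        (le_antisymm (LinearMap.finrank_le_finrank_of_injective hr) ?_)).1 hr⟩
      rwa [finrank_fintype_fun_eq_card, Fintype.card_coe]
    obtain ⟨w, hw, hwq⟩ := hpivot.exists_eq_on (Pi.single q 1)
    exact h.mem_eigenspaceOf_iff.1 (h.eq_of_mem_eigenspaceOf hw hwq ▸ hw) p
  · intro hzero
    have hsurj : Function.Surjective r := fun c => by
      refine ⟨∑ p, c p • ⟨u p, h.mem_eigenspaceOf_iff.2 fun q => hzero q p⟩, funext fun q => ?_⟩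
      change (∑ p, c p • (⟨u p, _⟩ : eigenspaceOf z.1.1 z.2)).1 q = c q
      simp [Finset.sum_apply, h.apply_pivot, Pi.single_apply]
    exact ((LinearEquiv.ofBijective r ⟨hr, hsurj⟩).finrank_eq.trans (by simp)).ge

end IsPivotFrame

omit [DecidableEq ι] in
theorem contDiffAt_dotProduct_shiftMulVec {U V : S × ℝ → ι → ℝ} {z₀ : S × ℝ}
    (hU : ContDiffAt ℝ ω U z₀) (hV : ContDiffAt ℝ ω V z₀) :
    ContDiffAt ℝ ω (fun z => U z ⬝ᵥ shiftMulVec S z (V z)) z₀ := by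
  let β : (ι → ℝ) →L[ℝ] (ι → ℝ) →L[ℝ] ℝ := (dotProductBilin ℝ ℝ).toContinuousBilinearMap
  exact (β.contDiff.contDiffAt.comp z₀ hU).clm_apply
    ((shiftMulVec S).contDiff.contDiffAt.clm_apply hV)

theorem fderiv_dotProduct_shiftMulVec (hS : ∀ A ∈ S, A.IsSymm) {U V : S × ℝ → ι → ℝ} {z₀ : S × ℝ}
    (hU : DifferentiableAt ℝ U z₀) (hV : DifferentiableAt ℝ V z₀)
    (hU₀ : U z₀ ∈ eigenspaceOf z₀.1.1 z₀.2) (hV₀ : V z₀ ∈ eigenspaceOf z₀.1.1 z₀.2) (ζ : S × ℝ) :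
    fderiv ℝ (fun z => U z ⬝ᵥ shiftMulVec S z (V z)) z₀ ζ = U z₀ ⬝ᵥ shiftMulVec S ζ (V z₀) := by
  let β : (ι → ℝ) →L[ℝ] (ι → ℝ) →L[ℝ] ℝ := (dotProductBilin ℝ ℝ).toContinuousBilinearMap
  have hβ : fderiv ℝ (fun z => U z ⬝ᵥ shiftMulVec S z (V z)) z₀ = _ :=
    ((β.hasFDerivAt.comp z₀ hU.hasFDerivAt).clm_apply
      ((shiftMulVec S).hasFDerivAt.clm_apply hV.hasFDerivAt)).fderiv
  rw [hβ]
  change U z₀ ⬝ᵥ (shiftMulVec S z₀ (fderiv ℝ V z₀ ζ) + shiftMulVec S ζ (V z₀)) +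
    fderiv ℝ U z₀ ζ ⬝ᵥ shiftMulVec S z₀ (V z₀) = _
  rw [dotProduct_add, dotProduct_shiftMulVec_of_mem_eigenspaceOf hS hU₀,
    mem_eigenspaceOf_iff_shiftMulVec_eq_zero.1 hV₀, dotProduct_zero, add_zero, zero_add]

end Frame

section DoubleEigenvalue

theorem eventually_forall_mem_of_isClosed_of_isCompact {X E : Type*} [TopologicalSpace X]
    [TopologicalSpace E] {Z V : Set (X × E)} {K : Set E} {z₀ : X × E} (hZ : IsClosed Z)
    (hK : IsCompact K) (hZK : ∀ᶠ x in 𝓝 z₀.1, ∀ s, (x, s) ∈ Z → s ∈ K)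
    (hfiber : ∀ s, (z₀.1, s) ∈ Z → s = z₀.2) (hV : V ∈ 𝓝 z₀) :
    ∀ᶠ x in 𝓝 z₀.1, ∀ s, (x, s) ∈ Z → (x, s) ∈ V := by
  have hlocal : ∀ s ∈ K, ∀ᶠ z : X × E in 𝓝 (z₀.1, s), z ∈ Z → z ∈ V := fun s _ => by
    by_cases hs : (z₀.1, s) ∈ Z
    · obtain rfl := hfiber s hs
      exact Filter.mem_of_superset hV fun z hz _ => hz
    · exact Filter.mem_of_superset (hZ.isOpen_compl.mem_nhds hs) fun z hz hzZ => absurd hzZ hz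
  filter_upwards [hZK, hK.eventually_forall_of_forall_eventually
    (P := fun x s => (x, s) ∈ Z → (x, s) ∈ V) hlocal] with x hxK hx s hs
  exact hx s (hxK s hs) hs

variable {ι : Type*} [Fintype ι] {S : Submodule ℝ (Matrix ι ι ℝ)}

theorem exists_dotProduct_mulVec_eq (hS : ∀ A ∈ S, A.IsSymm) {M : Submodule ℝ (ι → ℝ)}
    {x y : ι → ℝ} (hM : M ≤ Submodule.span ℝ {x, y})
    (hfinrank : finrank ℝ (zeroCompression S M) + 3 ≤ finrank ℝ S) (a b c : ℝ) :
    ∃ H : S, x ⬝ᵥ H.1 *ᵥ x = a ∧ y ⬝ᵥ H.1 *ᵥ x = b ∧ y ⬝ᵥ H.1 *ᵥ y = c := by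
  let T : S →ₗ[ℝ] ℝ × ℝ × ℝ :=
    { toFun H := (x ⬝ᵥ H.1 *ᵥ x, y ⬝ᵥ H.1 *ᵥ x, y ⬝ᵥ H.1 *ᵥ y)
      map_add' H H' := by simp [Matrix.add_mulVec, dotProduct_add]
      map_smul' s H := by simp [Matrix.smul_mulVec, dotProduct_smul] }
  have hker : LinearMap.ker T ≤ zeroCompression S M := fun H hH u hu v hv => by
    obtain ⟨hxx : x ⬝ᵥ H.1 *ᵥ x = 0, hyx_yy⟩ := Prod.ext_iff.1 hH
    obtain ⟨hyx : y ⬝ᵥ H.1 *ᵥ x = 0, hyy : y ⬝ᵥ H.1 *ᵥ y = 0⟩ := Prod.ext_iff.1 hyx_yy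
    have hxy : x ⬝ᵥ H.1 *ᵥ y = 0 := (dotProduct_mulVec_comm_of_isSymm (hS _ H.2) x y).trans hyx
    obtain ⟨p, q, rfl⟩ := Submodule.mem_span_pair.1 (hM hu)
    obtain ⟨r, s, rfl⟩ := Submodule.mem_span_pair.1 (hM hv)
    simp [Matrix.mulVec_add, Matrix.mulVec_smul, hxx, hyx, hyy, hxy]
  have hle := Submodule.finrank_mono hker
  have hrank := LinearMap.finrank_range_add_finrank_ker (K := ℝ) (V := S) T
  have hrange : LinearMap.range T = ⊤ := by
    refine Submodule.eq_top_of_finrank_eq (le_antisymm (Submodule.finrank_le _) ?_)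
    simp only [finrank_prod, finrank_self]
    omega
  obtain ⟨H, hH⟩ := LinearMap.range_eq_top.1 hrange (a, b, c)
  obtain ⟨hxx, hyx_yy⟩ := Prod.ext_iff.1 hH
  exact ⟨H, hxx, Prod.ext_iff.1 hyx_yy⟩

variable [DecidableEq ι]

theorem isClosed_setOf_le_finrank_eigenspaceOf (m : ℕ) :
    IsClosed {z : S × ℝ | m ≤ finrank ℝ (eigenspaceOf z.1.1 z.2)} := by
  have hrank (z : S × ℝ) : m ≤ finrank ℝ (eigenspaceOf z.1.1 z.2) ↔
      ¬ ((Fintype.card ι + 1 - m : ℕ) : Cardinal) ≤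
        (shiftMulVec S z : (ι → ℝ) →ₗ[ℝ] ι → ℝ).rank := by
    have hker : eigenspaceOf z.1.1 z.2 = (shiftMulVec S z : (ι → ℝ) →ₗ[ℝ] ι → ℝ).ker :=
      Submodule.ext fun w => mem_eigenspaceOf_iff_shiftMulVec_eq_zero
    have hadd := LinearMap.finrank_range_add_finrank_ker
      (shiftMulVec S z : (ι → ℝ) →ₗ[ℝ] ι → ℝ)
    rw [finrank_fintype_fun_eq_card] at hadd
    rw [hker, LinearMap.rank, ← finrank_eq_rank, Nat.cast_le]
    omega
  simp only [hrank]
  exact ((isOpen_setOfPred_nat_le_rank _).preimage (shiftMulVec S).continuous).isClosed_compl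

theorem abs_le_norm_shiftMulVec_of_eigenspaceOf_ne_bot {A : S} {μ : ℝ}
    (hμ : eigenspaceOf A.1 μ ≠ ⊥) : |μ| ≤ ‖shiftMulVec S (A, 0)‖ := by
  obtain ⟨w, hw, hw0⟩ := Submodule.exists_mem_ne_zero_of_ne_bot hμ
  have hAw : shiftMulVec S (A, 0) w = μ • w := by
    rw [shiftMulVec_apply, zero_smul, sub_zero, mem_eigenspaceOf.1 hw]
  refine le_of_mul_le_mul_right ?_ (norm_pos_iff.2 hw0)
  calc |μ| * ‖w‖ = ‖shiftMulVec S (A, 0) w‖ := by rw [hAw, norm_smul, Real.norm_eq_abs]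
    _ ≤ ‖shiftMulVec S (A, 0)‖ * ‖w‖ := ContinuousLinearMap.le_opNorm _ w

theorem eventually_forall_two_le_finrank_eigenspaceOf_mem {z₀ : S × ℝ} {V : Set (S × ℝ)}
    (huniq : ∀ ν, 2 ≤ finrank ℝ (eigenspaceOf z₀.1.1 ν) → ν = z₀.2) (hV : V ∈ 𝓝 z₀) :
    ∀ᶠ A : S in 𝓝 z₀.1, ∀ μ, 2 ≤ finrank ℝ (eigenspaceOf A.1 μ) → (A, μ) ∈ V := by
  have hcont : Continuous fun A : S => ‖shiftMulVec S (A, 0)‖ := by fun_prop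
  refine eventually_forall_mem_of_isClosed_of_isCompact (isClosed_setOf_le_finrank_eigenspaceOf 2)
    (isCompact_Icc (a := -(‖shiftMulVec S (z₀.1, 0)‖ + 1)) (b := ‖shiftMulVec S (z₀.1, 0)‖ + 1))
    ?_ huniq hV
  filter_upwards [hcont.continuousAt.eventually_lt_const (lt_add_one _)] with A hA μ hμ
  refine abs_le.1 ((abs_le_norm_shiftMulVec_of_eigenspaceOf_ne_bot ?_).trans hA.le)
  exact Submodule.one_le_finrank_iff.1 (one_le_two.trans hμ)

theorem exists_local_equations_of_finrank_eigenspaceOf_eq_two (hS : ∀ A ∈ S, A.IsSymm)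
    {z₀ : S × ℝ} (hM : finrank ℝ (eigenspaceOf z₀.1.1 z₀.2) = 2) :
    ∃ (g : S × ℝ → ℝ) (h : S × ℝ → ℝ × ℝ) (x y : ι → ℝ),
      ContDiffAt ℝ ω g z₀ ∧ ContDiffAt ℝ ω h z₀ ∧
      (∀ᶠ z in 𝓝 z₀, 2 ≤ finrank ℝ (eigenspaceOf z.1.1 z.2) ↔ g z = 0 ∧ h z = 0) ∧
      x ≠ 0 ∧ eigenspaceOf z₀.1.1 z₀.2 ≤ Submodule.span ℝ {x, y} ∧
      (∀ ζ, fderiv ℝ g z₀ ζ = x ⬝ᵥ shiftMulVec S ζ x) ∧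
      ∀ ζ, fderiv ℝ h z₀ ζ = (y ⬝ᵥ shiftMulVec S ζ x, y ⬝ᵥ shiftMulVec S ζ y) := by
  obtain ⟨P, hP⟩ := exists_isPivotSet (eigenspaceOf z₀.1.1 z₀.2)
  have hcard : P.card = 2 := hP.finrank_eq.symm.trans hM
  obtain ⟨p, q, hpq, huniv⟩ := Finset.card_eq_two.1 (P.card_attach.trans hcard)
  have hforall {Q : P → Prop} : (∀ r, Q r) ↔ Q p ∧ Q q := by
    have hr := Finset.forall_mem_insert p {q} Q
    rw [← huniv] at hr
    simpa using hr
  obtain ⟨U, hU, hframe⟩ := exists_isPivotFrame hS hP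
  have hframe₀ := hframe.self_of_nhds
  have hU₀ (r : P) : U r z₀ ∈ eigenspaceOf z₀.1.1 z₀.2 := hframe₀.mem_eigenspaceOf_iff.2 fun r' =>
    hframe₀.card_le_finrank_eigenspaceOf_iff.1 (hcard.trans hM.symm).le r' r
  have hG (r r' : P) := contDiffAt_dotProduct_shiftMulVec (hU r) (hU r')
  have hG' (r r' : P) := fderiv_dotProduct_shiftMulVec hS ((hU r).differentiableAt (by simp))
    ((hU r').differentiableAt (by simp)) (hU₀ r) (hU₀ r')
  refine ⟨_, _, U p z₀, U q z₀, hG p p, (hG q p).prodMk (hG q q), ?_, ?_, ?_, hG' p p,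
    fun ζ => ?_⟩
  · filter_upwards [hframe] with z hz
    rw [← hcard, hz.card_le_finrank_eigenspaceOf_iff, hforall, hforall, hforall]
    simp only [Prod.mk_eq_zero, dotProduct_shiftMulVec_comm hS z (U p z) (U q z)]
    tauto
  · intro h0
    simpa [h0] using hframe₀.apply_pivot p p
  · intro w hw
    rw [hP.eq_sum hU₀ hframe₀.apply_pivot hw, ← Finset.attach_eq_univ, huniv,
      Finset.sum_pair hpq]
    exact Submodule.mem_span_pair.2 ⟨_, _, rfl⟩
  · rw [← hG' q p ζ, ← hG' q q ζ]
    exact DFunLike.congr_fun (DifferentiableAt.fderiv_prodMk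
      ((hG q p).differentiableAt (by simp)) ((hG q q).differentiableAt (by simp))) ζ

theorem isSubmanifoldAt_setOf_two_le_finrank_eigenspaceOf (hS : ∀ A ∈ S, A.IsSymm)
    (hdiag : ∀ d, Matrix.diagonal d ∈ S) {z₀ : S × ℝ}
    (hM : finrank ℝ (eigenspaceOf z₀.1.1 z₀.2) = 2)
    (huniq : ∀ ν, 2 ≤ finrank ℝ (eigenspaceOf z₀.1.1 ν) → ν = z₀.2)
    (hsep : SeparatesPairs S (eigenspaceOf z₀.1.1 z₀.2)) :
    IsSubmanifoldAt (finrank ℝ S - 2) {A : S | ∃ μ, 2 ≤ finrank ℝ (eigenspaceOf A.1 μ)} z₀.1 := by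
  obtain ⟨g, h, x, y, hg, hh, hZ, hx, hspan, hg', hh'⟩ :=
    exists_local_equations_of_finrank_eigenspaceOf_eq_two hS hM
  have hfinrank := finrank_zeroCompression_add_le hdiag hM.ge hsep
  rw [hM] at hfinrank
  refine isSubmanifoldAt_setOf_exists_of_eliminate
    (Z := {z : S × ℝ | 2 ≤ finrank ℝ (eigenspaceOf z.1.1 z.2)}) hg hh hM.ge hZ
    (fun V hV => eventually_forall_two_le_finrank_eigenspaceOf_mem huniq hV) ?_ ?_ ?_
  · refine ⟨ContinuousLinearEquiv.unitsEquivAut ℝ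
      (Units.mk0 (-(x ⬝ᵥ x)) (neg_ne_zero.2 (dotProduct_self_eq_zero.not.2 hx))), ?_⟩
    ext
    refine Eq.trans ?_ (hg' (0, 1)).symm
    simp [shiftMulVec_apply]
  · rintro ⟨b, c⟩
    obtain ⟨H, hxx, hyx, hyy⟩ := exists_dotProduct_mulVec_eq hS hspan hfinrank 0 b c
    exact ⟨H, (hg' _).trans (by simp [shiftMulVec_apply, hxx]),
      (hh' _).trans (by simp [shiftMulVec_apply, hyx, hyy])⟩
  · rw [finrank_prod, finrank_self]
    omega

end DoubleEigenvalue

section Codimension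

variable {ι : Type*} [Fintype ι] [DecidableEq ι] {G : SimpleGraph ι}

theorem dimH_setOf_not_isSubmanifoldAt_le (hG : G.Connected) :
    dimH {A ∈ {A : graphSymm G | ∃ μ, 2 ≤ finrank ℝ (eigenspaceOf A.1 μ)} |
      ¬ IsSubmanifoldAt (finrank ℝ (graphSymm G) - 2)
        {A : graphSymm G | ∃ μ, 2 ≤ finrank ℝ (eigenspaceOf A.1 μ)} A} ≤
      (finrank ℝ (graphSymm G) - 3 : ℕ) := by
  let S := graphSymm G
  have hS : ∀ A ∈ S, A.IsSymm := fun A hA => hA.1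
  have hunion := max_le (max_le (dimH_setOf_exists_not_separatesPairs_le hG)
    (dimH_setOf_three_le_finrank_eigenspaceOf_le hS diagonal_mem_graphSymm))
    (dimH_setOf_two_double_eigenvalues_le (G := G))
  rw [← dimH_union, ← dimH_union] at hunion
  refine (dimH_mono ?_).trans hunion
  rintro A ⟨⟨μ, hμ⟩, hA⟩
  by_contra! hnot
  simp only [mem_union, mem_ofPred_eq, not_or, not_exists, not_and, not_not, not_le] at hnot
  obtain ⟨⟨hsep, hlt⟩, hdouble⟩ := hnot
  have hdim {ν : ℝ} (hν : 2 ≤ finrank ℝ (eigenspaceOf A.1 ν)) :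
      finrank ℝ (eigenspaceOf A.1 ν) = 2 := le_antisymm (Nat.le_of_lt_succ (hlt ν (hsep ν))) hν
  refine hA (isSubmanifoldAt_setOf_two_le_finrank_eigenspaceOf (z₀ := (A, μ)) hS
    diagonal_mem_graphSymm (hdim hμ) (fun ν hν => ?_) (hsep μ))
  by_contra hne
  exact hdouble ν μ hne ⟨hsep ν, hdim hν⟩ (hsep μ) (hdim hμ)

theorem hasCodimension_two_of_double_eigenvalue (hG : G.Connected) {Ω : Set (graphSymm G)}
    (hΩ : IsOpen Ω) {A : graphSymm G} (hA : A ∈ Ω) {μ : ℝ}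
    (hμ : finrank ℝ (eigenspaceOf A.1 μ) = 2)
    (huniq : ∀ ν, 2 ≤ finrank ℝ (eigenspaceOf A.1 ν) → ν = μ)
    (hsep : SeparatesPairs (graphSymm G) (eigenspaceOf A.1 μ)) :
    HasCodimension ({A : graphSymm G | ∃ μ, 2 ≤ finrank ℝ (eigenspaceOf A.1 μ)} ∩ Ω) 2 := by
  have hdim : 3 ≤ finrank ℝ (graphSymm G) := by
    have := finrank_zeroCompression_add_le diagonal_mem_graphSymm hμ.ge hsep
    omega
  refine hasCodimension_inter_of_dimH_lt hΩ (by omega) ⟨⟨μ, hμ.ge⟩, hA⟩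
    (isSubmanifoldAt_setOf_two_le_finrank_eigenspaceOf (z₀ := (A, μ)) (S := graphSymm G)
      (fun A hA => hA.1) diagonal_mem_graphSymm hμ huniq hsep)
    ((dimH_setOf_not_isSubmanifoldAt_le hG).trans_lt ?_)
  exact_mod_cast (by omega : finrank ℝ (graphSymm G) - 3 < finrank ℝ (graphSymm G) - 2)

end Codimension

section Witness

variable {ι : Type*} [Fintype ι] [DecidableEq ι] {G : SimpleGraph ι}

theorem finrank_eigenspaceOf_eq_card {A : Matrix ι ι ℝ} {c : ι → ℝ}
    (U : (ι → ℝ) ≃ₗ[ℝ] (ι → ℝ)) (hU : ∀ w, U (A *ᵥ w) = c * U w) (μ : ℝ) :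
    finrank ℝ (eigenspaceOf A μ) = Fintype.card {l // c l = μ} := by
  have hmem (w : ι → ℝ) : w ∈ eigenspaceOf A μ ↔ ∀ l, c l ≠ μ → U w l = 0 := by
    rw [mem_eigenspaceOf, ← U.injective.eq_iff, hU, map_smul, funext_iff]
    refine forall_congr' fun l => ?_
    rw [Pi.mul_apply, Pi.smul_apply, smul_eq_mul, mul_eq_mul_right_iff, or_iff_not_imp_left]
  let R : eigenspaceOf A μ →ₗ[ℝ] ({l // c l = μ} → ℝ) :=
    LinearMap.funLeft ℝ ℝ Subtype.val ∘ₗ U.toLinearMap ∘ₗ (eigenspaceOf A μ).subtype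
  have hR : Function.Bijective R := by
    refine ⟨(injective_iff_map_eq_zero R).2 fun w hw => ?_, fun f => ?_⟩
    · refine Subtype.ext (U.map_eq_zero_iff.1 (funext fun l => ?_))
      by_cases hl : c l = μ
      · exact congrFun hw ⟨l, hl⟩
      · exact (hmem w).1 w.2 l hl
    · let v := Function.extend Subtype.val f 0
      refine ⟨⟨U.symm v, (hmem _).2 fun l hl => ?_⟩, funext fun l => ?_⟩
      · rw [U.apply_symm_apply]
        exact Function.extend_apply' _ _ _ fun ⟨l', hl'⟩ => hl (hl' ▸ l'.2)
      · change U (U.symm v) l = f l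
        rw [U.apply_symm_apply]
        exact Subtype.val_injective.extend_apply _ _ l
  rw [(LinearEquiv.ofBijective R hR).finrank_eq, finrank_fintype_fun_eq_card]

theorem hasCodimension_two_of_diagonalization (hG : G.Connected) {Ω : Set (graphSymm G)}
    (hΩ : IsOpen Ω) {A : graphSymm G} (hA : A ∈ Ω) (U : (ι → ℝ) ≃ₗ[ℝ] (ι → ℝ)) {c : ι → ℝ}
    (hU : ∀ w, U (A.1 *ᵥ w) = c * U w) {p q : ι} (hpq : p ≠ q) (hc : c p = c q)
    (hinj : InjOn c {q}ᶜ) {i j : ι} (hij : G.Adj i j)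
    (hcoords : ∀ w, (∀ l, l ≠ p → l ≠ q → U w l = 0) → w i = 0 → w j = 0 → w = 0) :
    HasCodimension ({A : graphSymm G | ∃ μ, 2 ≤ finrank ℝ (eigenspaceOf A.1 μ)} ∩ Ω) 2 := by
  have hfiber (l : ι) : c l = c p ↔ l = p ∨ l = q := by
    refine ⟨fun h => or_iff_not_imp_right.2 fun hl => hinj hl hpq h, ?_⟩
    rintro (rfl | rfl)
    exacts [rfl, hc.symm]
  refine hasCodimension_two_of_double_eigenvalue hG hΩ hA (μ := c p) ?_ (fun ν hν => ?_)
    (separatesPairs_graphSymm_of_adj hij fun w hw => hcoords w fun l hlp hlq => ?_)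
  · rw [finrank_eigenspaceOf_eq_card U hU, Fintype.card_subtype, ← Finset.card_pair hpq]
    congr 1
    ext l
    simp [hfiber]
  · rw [finrank_eigenspaceOf_eq_card U hU] at hν
    obtain ⟨⟨l, rfl⟩, ⟨m, hm⟩, hlm⟩ := Fintype.one_lt_card_iff.1 hν
    by_cases hl : l = q
    · rw [hl, hc]
    by_cases hmq : m = q
    · rw [← hm, hmq, hc]
    exact absurd (Subtype.ext (hinj hl hmq hm.symm)) hlm
  · have h := congrFun (hU w) l
    rw [mem_eigenspaceOf.1 hw, map_smul] at h
    exact (mul_eq_mul_right_iff.1 h).resolve_left fun h => ((hfiber l).1 h.symm).elim hlp hlq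

theorem exists_injective_one_lt (ι : Type*) [Finite ι] :
    ∃ a : ι → ℝ, Function.Injective a ∧ ∀ l, 1 < a l := by
  obtain ⟨n, ⟨e⟩⟩ := Finite.exists_equiv_fin ι
  refine ⟨fun l => (e l : ℕ) + 2, fun l m h => e.injective (Fin.ext ?_), fun l => ?_⟩
  · exact_mod_cast add_right_cancel h
  · have : (0 : ℝ) ≤ (e l : ℕ) := Nat.cast_nonneg _
    linarith

theorem hasCodimension_two_of_connected [Nontrivial ι] (hG : G.Connected) :
    HasCodimension {A : graphSymm G | ∃ μ, 2 ≤ finrank ℝ (eigenspaceOf A.1 μ)} 2 := by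
  obtain ⟨a, ha, -⟩ := exists_injective_one_lt ι
  obtain ⟨i₀, j₀, hne⟩ := exists_pair_ne ι
  obtain ⟨i, -, j, -, hij⟩ := exists_adj_notMem_mem hG (mem_singleton i₀) hne.symm
  have hij' := hij.ne
  let c := Function.update a j (a i)
  have hdiag (w : ι → ℝ) : Matrix.diagonal c *ᵥ w = c * w :=
    funext fun l => Matrix.mulVec_diagonal c w l
  have hc {l : ι} (hl : l ≠ j) : c l = a l := Function.update_of_ne hl _ _
  rw [← inter_univ {A : graphSymm G | _}]
  refine hasCodimension_two_of_diagonalization hG isOpen_univ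
    (A := ⟨Matrix.diagonal c, diagonal_mem_graphSymm c⟩) (mem_univ _) (LinearEquiv.refl ℝ _) hdiag
    hij' (by simp [c, hij']) (fun l hl m hm h => ha (by rwa [hc hl, hc hm] at h)) hij
    fun w hw hwi hwj => funext fun l => ?_
  by_cases hli : l = i
  · rw [hli, hwi, Pi.zero_apply]
  by_cases hlj : l = j
  · rw [hlj, hwj, Pi.zero_apply]
  exact hw l hli hlj

theorem exists_diagonalization_diagonal_add_symUnit {o s : ι} (hos : o ≠ s) {c : ι → ℝ}
    (ho : c o = -1) (hs : c s = 1) :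
    ∃ U : (ι → ℝ) ≃ₗ[ℝ] (ι → ℝ),
      (∀ w, U ((Matrix.diagonal (c - Pi.single o (c o) - Pi.single s (c s)) + symUnit o s) *ᵥ w) =
        c * U w) ∧
      ∀ w, U w o = w o - w s ∧ ∀ l, l ≠ o → l ≠ s → U w l = w l := by
  let U : (ι → ℝ) →ₗ[ℝ] (ι → ℝ) := LinearMap.id
    - LinearMap.single ℝ (fun _ => ℝ) o ∘ₗ LinearMap.proj s
    + LinearMap.single ℝ (fun _ => ℝ) s ∘ₗ LinearMap.proj o
  have hUo (w : ι → ℝ) : U w o = w o - w s := by simp [U, hos]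
  have hUs (w : ι → ℝ) : U w s = w s + w o := by simp [U, hos.symm]
  have hUl (w : ι → ℝ) (l : ι) (hlo : l ≠ o) (hls : l ≠ s) : U w l = w l := by
    simp [U, hlo, hls]
  have hU : Function.Injective U := (injective_iff_map_eq_zero U).2 fun w hw => by
    have hwo := (hUo w).symm.trans (congrFun hw o)
    have hws := (hUs w).symm.trans (congrFun hw s)
    rw [Pi.zero_apply] at hwo hws
    funext l
    by_cases hlo : l = o
    · rw [hlo, Pi.zero_apply]
      linarith
    by_cases hls : l = s
    · rw [hls, Pi.zero_apply]
      linarith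
    rw [← hUl w l hlo hls, hw]
  refine ⟨.ofInjectiveEndo U hU, fun w => funext fun l => ?_, fun w => ⟨hUo w, hUl w⟩⟩
  rw [LinearEquiv.coe_ofInjectiveEndo, Pi.mul_apply, Matrix.add_mulVec, symUnit_mulVec]
  by_cases hlo : l = o
  · simp [hlo, hUo, Matrix.mulVec_diagonal, hos, hos.symm, ho]
  by_cases hls : l = s
  · simp [hls, hUs, Matrix.mulVec_diagonal, hos, hos.symm, hs, add_comm]
  simp [hUl _ l hlo hls, Matrix.mulVec_diagonal, hlo, hls]

theorem hasCodimension_two_inter_of_adj (hG : G.Connected) (hι : 3 ≤ Fintype.card ι)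
    {Ω : Set (graphSymm G)} (hΩ : IsOpen Ω) {o s : ι} (hos : G.Adj o s)
    (hmem : ∀ A : graphSymm G, A.1 o s ≠ 0 → A ∈ Ω) :
    HasCodimension ({A : graphSymm G | ∃ μ, 2 ≤ finrank ℝ (eigenspaceOf A.1 μ)} ∩ Ω) 2 := by
  obtain ⟨a, ha, ha1⟩ := exists_injective_one_lt ι
  obtain ⟨j₀, -, hj₀⟩ := Finset.exists_mem_notMem_of_card_lt_card
    (s := {o, s}) (t := Finset.univ) (Finset.card_le_two.trans_lt hι)
  obtain ⟨j, hj, m, hm, hjm⟩ := exists_adj_notMem_mem hG (mem_insert o {s}) (j := j₀)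
    (by simpa using hj₀)
  obtain ⟨hjo, hjs⟩ : j ≠ o ∧ j ≠ s := by simpa using hj
  let c (l : ι) : ℝ := if l = o then -1 else if l = s ∨ l = j then 1 else a l
  have hco : c o = -1 := if_pos rfl
  have hcs : c s = 1 := by simp [c, hos.ne']
  obtain ⟨U, hU, hUw⟩ := exists_diagonalization_diagonal_add_symUnit hos.ne hco hcs
  refine hasCodimension_two_of_diagonalization hG hΩ (A := ⟨_, add_mem
    (diagonal_mem_graphSymm _) (symUnit_mem_graphSymm (.inr hos))⟩) (hmem _ ?_) U hU hjs.symm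
    (by simp [c, hjo, hos.ne']) (fun l hl m hm h => ?_) hjm fun w hw hwj hwm => funext fun l => ?_
  · simp [symUnit, hos.ne, hos.ne']
  · have := ha1 l
    have := ha1 m
    have := @ha l m
    simp only [mem_compl_iff, mem_singleton_iff] at hl hm
    simp only [c, hl, hm, or_false] at h
    grind
  · have hwos : w o = w s := sub_eq_zero.1 ((hUw w).1.symm.trans (hw o hos.ne hjo.symm))
    have hwo : w o = 0 := by
      obtain rfl | rfl := hm
      exacts [hwm, hwos.trans hwm]
    by_cases hlo : l = o
    · rw [hlo, hwo, Pi.zero_apply]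
    by_cases hls : l = s
    · rw [hls, ← hwos, hwo, Pi.zero_apply]
    by_cases hlj : l = j
    · rw [hlj, hwj, Pi.zero_apply]
    rw [← (hUw w).2 l hlo hls, hw l hls hlj, Pi.zero_apply]

end Witness

section Main

theorem mainTheorem5_general {n : ℕ} {G : SimpleGraph (Fin n)} (hG : G.Connected) (hn : 2 ≤ n) :
    HasCodimension {A : graphSymm G | IsDerogatory A.1} 2 ∧
    (3 ≤ n → ∀ F : Set (Fin n × Fin n), (∃ e ∈ F, G.Adj e.1 e.2) →
      HasCodimension {A : graphSymm G | IsDerogatory A.1 ∧ ∃ e ∈ F, A.1 e.1 e.2 ≠ 0} 2) := by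
  have : Nontrivial (Fin n) := Fin.nontrivial_iff_two_le.2 hn
  refine ⟨hasCodimension_two_of_connected hG, fun hn' F ⟨e, he, hadj⟩ => ?_⟩
  refine hasCodimension_two_inter_of_adj hG (by simpa using hn')
    (Ω := {A : graphSymm G | ∃ e ∈ F, A.1 e.1 e.2 ≠ 0}) ?_ hadj fun A hA => ⟨e, he, hA⟩
  have hunion : {A : graphSymm G | ∃ e ∈ F, A.1 e.1 e.2 ≠ 0} =
      ⋃ e ∈ F, {A : graphSymm G | A.1 e.1 e.2 ≠ 0} := by
    ext A
    simp
  rw [hunion]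
  exact isOpen_biUnion fun e _ => isOpen_ne_fun
    (continuous_subtype_val.matrix_elem e.1 e.2) continuous_const

/-- The graph on `{0, …, n - 1}` in which distinct vertices at distance at most `k` are adjacent;
the matrices supported on it are those of bandwidth at most `k`. -/
def bandGraph (n k : ℕ) : SimpleGraph (Fin n) where
  Adj l m := l ≠ m ∧ ((m : ℤ) - (l : ℤ)).natAbs ≤ k
  symm := ⟨fun l m ⟨hne, _⟩ => ⟨hne.symm, by omega⟩⟩
  loopless := ⟨fun _ h => h.1 rfl⟩

theorem bandGraph_connected {n k : ℕ} (hn : n ≠ 0) (hk : 0 < k) : (bandGraph n k).Connected := by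
  obtain ⟨n, rfl⟩ := Nat.exists_eq_succ_of_ne_zero hn
  refine (SimpleGraph.pathGraph_connected n).mono fun l m h => ?_
  rw [SimpleGraph.pathGraph_adj] at h
  exact ⟨by omega, by omega⟩

theorem bandedSymm_eq_graphSymm (n k : ℕ) : bandedSymm n k = graphSymm (bandGraph n k) := by
  ext A
  refine and_congr_right fun _ => (bandwidth_le_iff A k).trans
    (forall₂_congr fun l m => ⟨fun h hne hadj => h ?_, fun h hlm => h ?_ ?_⟩)
  · exact not_le.1 fun hle => hadj ⟨hne, hle⟩
  · rintro rfl
    simp at hlm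
  · exact fun hadj => hlm.not_ge hadj.2

theorem bandwidth_eq_iff_exists {K : Type*} [Zero K] {n k : ℕ} (hk : 0 < k)
    {A : Matrix (Fin n) (Fin n) K} (hA : bandwidth A ≤ k) :
    bandwidth A = k ↔
      ∃ e ∈ {e : Fin n × Fin n | ((e.2 : ℤ) - (e.1 : ℤ)).natAbs = k}, A e.1 e.2 ≠ 0 := by
  have hlt : bandwidth A = k ↔ ¬ bandwidth A ≤ k - 1 := by omega
  rw [hlt, bandwidth_le_iff]
  push Not
  rw [bandwidth_le_iff] at hA
  constructor
  · rintro ⟨l, m, hlm, hne⟩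
    exact ⟨(l, m), le_antisymm (not_lt.1 fun h => hne (hA l m h)) (Nat.le_of_pred_lt hlm), hne⟩
  · rintro ⟨⟨l, m⟩, rfl, hne⟩
    exact ⟨l, m, Nat.sub_one_lt hk.ne', hne⟩

end Main

theorem mainTheorem5 (n k : ℕ) (hk : 0 < k) (hkn : k ≤ n - 1) :
    HasCodimension
      {A : bandedSymm n k | IsDerogatory (A : Matrix (Fin n) (Fin n) ℝ)} 2 ∧
    (3 ≤ n → HasCodimension
      {A : bandedSymm n k | IsDerogatory (A : Matrix (Fin n) (Fin n) ℝ) ∧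
        bandwidth (A : Matrix (Fin n) (Fin n) ℝ) = k} 2) := by
  have hbandwidth : {A : bandedSymm n k | IsDerogatory A.1 ∧ bandwidth A.1 = k} =
      {A : bandedSymm n k | IsDerogatory A.1 ∧
        ∃ e ∈ {e : Fin n × Fin n | ((e.2 : ℤ) - (e.1 : ℤ)).natAbs = k}, A.1 e.1 e.2 ≠ 0} :=
    ext fun A => and_congr_right fun _ => bandwidth_eq_iff_exists hk A.2.2
  have hedge : (bandGraph n k).Adj ⟨0, by omega⟩ ⟨k, by omega⟩ :=
    ⟨Fin.ne_of_val_ne hk.ne, by simp⟩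
  rw [hbandwidth, bandedSymm_eq_graphSymm]
  obtain ⟨hle, heq⟩ := mainTheorem5_general (bandGraph_connected (n := n) (by omega) hk) (by omega)
  exact ⟨hle, fun hn => heq hn _ ⟨⟨⟨0, by omega⟩, ⟨k, by omega⟩⟩, by simp, hedge⟩⟩
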